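/- For real numbers $c_0,c_1,c_2,c_3$ let $m_0(\xi)=\frac1{\sqrt2}\sum_{k=0}^{3}c_k e^{-ik\xi}$. Call $m_0$ an orthonormal scaling filter with $4$ coefficients if $m_0(0)=1$ and $|m_0(\xi)|^2+|m_0(\pi+\xi)|^2=1$ for all $\xi\in\mathbb R$; its number of vanishing moments is the order of its zero at $\pi$. It is a Daubechies filter if this order is maximal, i.e. equal to $2$. For $v\in\mathbb R$ let $$r_v(\xi)=-\tfrac v2\cos^2\xi+\tfrac v2\cos\xi+1,$$ and let $T_{r}$ be the operator $T_{r}u(\xi)=r(\xi/2)\,u(\xi/2)+r(\pi-\xi/2)\,u(\pi-\xi/2)$ on $C[0,\pi]$ (complex-valued functions), with spectral radius $\rho(T_r)$. (1) For every $v\in\mathbb R$, $r_v(\pi)\ge0$ if and only if $v\le1$. The functions $1,\cos\xi,\cos2\xi$ are linearly independent, $T_{r_v}$ maps their span into itself, and the coefficients of the images of $1,\cos\xi,\cos2\xi$ are the rows of $$\frac14\begin{pmatrix}8-2v&-2v&0\\2v&2v&0\\-v&8-2v&-v\end{pmatrix}.$$ If $v\le1$, the eigenvalues of $T_{r_v}$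 on this span are, with multiplicity, $1+\sqrt{1-v}$, $1-\sqrt{1-v}$ and $-\frac v4$, and $\rho(T_{r_v})\ge1$. (2) For every orthonormal scaling filter $m_0$ with $4$ coefficients and at least one vanishing moment there is exactly one $v\in\mathbb R$ with $$|m_0(\xi)|^2=\tfrac12+\bigl(\tfrac12-a_3\bigr)\cos\xi+a_3\cos3\xi\quad(\xi\in\mathbb R),\qquad a_3=-\tfrac v{16};$$ for this $v$ one has $|m_0(\xi)|^2=\frac{1+\cos\xi}2\,r_v(\xi)$ for all $\xi$ and $v\le1$, and $v=1$ if and only if $m_0$ is a Daubechies filter. A number $v$ occurs in this way for some filter if and only if $r_v\ge0$ on $\mathbb R$. (3) For every filter as in (2) there is exactly one $\phi\in L^2(\mathbb R)$ which satisfies the dilation equation $\phi(x)=\sqrt2\sum_{k=0}^3c_k\phi(2x-k)$ for almost every $x$ and for which $\widehat\phi(\xi)=\prod_{j=1}^\infty m_0(2^{-j}\xi)$ for almost every $\xi$, where $\widehat f(\xi)=\int f(x)e^{-ix\xi}\,dx$ (extended to $L^2(\mathbb R)$). Let $H^s$ be the set of all $f\in L^2(\mathbb R)$ with $(1+|\xi|^2)^{s/2}\widehat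 f(\xi)\in L^2(\mathbb R)$. Then $\{s\in\mathbb R:\phi\in H^s\}$ is non-empty and bounded above, and its supremum $s_0$ satisfies $s_0\le1$. If $v=1$ (the Daubechies case), then $s_0=1$; if $v<1$, then $s_0<1$. -/

import Mathlib

open MeasureTheory

noncomputable section

namespace Wavelet

/-- The scaling filter `m₀(ξ) = (1/√2) ∑ₖ cₖ e^{-ikξ}` with the four real coefficients
`c₀, c₁, c₂, c₃`. -/
def m0 (c : Fin 4 → ℝ) (ξ : ℝ) : ℂ :=
  1 / (√2 : ℝ) * ∑ k : Fin 4, (c k : ℂ) * Complex.exp (-Complex.I * ((k : ℕ) : ℂ) * (ξ : ℂ))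

/-- Orthonormal scaling filters with four coefficients. -/
structure IsOrthonormalFilter (c : Fin 4 → ℝ) : Prop where
  map_zero : m0 c 0 = 1
  ortho : ∀ ξ : ℝ, ‖m0 c ξ‖ ^ 2 + ‖m0 c (Real.pi + ξ)‖ ^ 2 = 1

/-- The number of vanishing moments: the order of the zero of `m₀` at `π`. -/
def vanishingMoments (c : Fin 4 → ℝ) : ℕ∞ :=
  analyticOrderAt (m0 c) Real.pi

/-- The Daubechies filters with four coefficients: orthonormal filters for which the zero at `π`
has the maximal order `2`. -/
def IsDaubechiesFilter (c : Fin 4 → ℝ) : Prop :=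
  IsOrthonormalFilter c ∧ vanishingMoments c = 2

/-- `c` has parameter `v` if `|m₀(ξ)|² = 1/2 + a₁ cos ξ + a₃ cos 3ξ` with `a₃ = -v/16`
and `a₁ = 1/2 - a₃`. -/
def HasParameter (c : Fin 4 → ℝ) (v : ℝ) : Prop :=
  ∀ ξ : ℝ, ‖m0 c ξ‖ ^ 2 =
    1 / 2 + (1 / 2 - (-v / 16)) * Real.cos ξ + (-v / 16) * Real.cos (3 * ξ)

/-- `r(ξ) = -(v/2) cos² ξ + (v/2) cos ξ + 1`. -/
def r (v : ℝ) : C(ℝ, ℝ) where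
  toFun ξ := -(v / 2) * Real.cos ξ ^ 2 + v / 2 * Real.cos ξ + 1
  continuous_toFun := by fun_prop

/-- The interval `[0, π]`. -/
abbrev I0π : Type := Set.Icc (0 : ℝ) Real.pi

/-- The map `ξ ↦ ξ/2` of `[0, π]`. -/
def half : C(I0π, I0π) where
  toFun ξ := ⟨(ξ : ℝ) / 2, by
    have h := ξ.2
    constructor <;> linarith [h.1, h.2]⟩
  continuous_toFun := by fun_prop

/-- The map `ξ ↦ π - ξ/2` of `[0, π]`. -/
def coHalf : C(I0π, I0π) where
  toFun ξ := ⟨Real.pi - (ξ : ℝ) / 2, by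
    have h := ξ.2
    constructor <;> linarith [h.1, h.2]⟩
  continuous_toFun := by fun_prop

/-- The restriction of `r` to `[0, π]`, as a complex-valued function. -/
def restr (r : C(ℝ, ℝ)) : C(I0π, ℂ) where
  toFun ξ := (r ξ : ℂ)
  continuous_toFun := by fun_prop

/-- The operator `T_r u(ξ) = r(ξ/2) u(ξ/2) + r(π-ξ/2) u(π-ξ/2)` on `C[0, π]`. -/
def T (r : C(ℝ, ℝ)) : C(I0π, ℂ) →L[ℂ] C(I0π, ℂ) :=
  (half.compCLM ℂ ℂ + coHalf.compCLM ℂ ℂ) ∘L ContinuousLinearMap.mul ℂ C(I0π, ℂ) (restr r)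

theorem T_apply (r : C(ℝ, ℝ)) (u : C(I0π, ℂ)) (ξ : I0π) :
    T r u ξ = (r ((ξ : ℝ) / 2) : ℂ) * u (half ξ)
      + (r (Real.pi - (ξ : ℝ) / 2) : ℂ) * u (coHalf ξ) := rfl

/-- The functions `1, cos ξ, cos 2ξ` on `[0, π]`. -/
def cosFun (k : Fin 3) : C(I0π, ℂ) where
  toFun ξ := (Real.cos ((k : ℕ) * (ξ : ℝ)) : ℂ)
  continuous_toFun := by fun_prop

/-- The span of `1, cos ξ, cos 2ξ` in `C[0, π]`. -/
def cosSpan : Submodule ℂ C(I0π, ℂ) :=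
  Submodule.span ℂ (Set.range cosFun)

/-- `μ` is an eigenvalue of `T_r` on the span of `1, cos ξ, cos 2ξ`. -/
def IsEigenvalueOnSpan (r : C(ℝ, ℝ)) (μ : ℂ) : Prop :=
  ∃ u ∈ cosSpan, u ≠ 0 ∧ T r u = μ • u

/-- The matrix of `T_r` on `1, cos ξ, cos 2ξ`; row `i` lists the coefficients of the image of the
`i`-th function. -/
def transferMatrix (v : ℝ) : Matrix (Fin 3) (Fin 3) ℝ :=
  (1 / 4 : ℝ) • !![8 - 2 * v, -2 * v, 0; 2 * v, 2 * v, 0; -v, 8 - 2 * v, -v]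

/-- The complex Hilbert space `L²(ℝ)`. -/
abbrev L2 : Type := Lp ℂ 2 (volume : Measure ℝ)

/-- The Fourier transform on `L²(ℝ)` in the normalization `∫ f(x) e^{-ixξ} dx`; Mathlib's
transform has the kernel `e^{-2πixξ}`. -/
def hat (f : L2) (ξ : ℝ) : ℂ :=
  (FourierTransform.fourier f : L2) (ξ / (2 * Real.pi))

/-- `f ∈ H^s`: `f ∈ L²(ℝ)` and `(1 + |ξ|²)^{s/2} f̂(ξ)` belongs to `L²(ℝ)`. -/
def MemH (s : ℝ) (f : L2) : Prop :=
  MemLp (fun ξ : ℝ => (((1 + |ξ| ^ 2) ^ (s / 2) : ℝ) : ℂ) * hat f ξ) 2 volume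

/-- `φ` is the scaling function of the filter: the solution of the dilation equation
`φ(x) = √2 ∑ₖ cₖ φ(2x - k)` that is given by `φ̂(ξ) = ∏_{j ≥ 1} m₀(2^{-j} ξ)`. -/
structure IsScalingFunction (c : Fin 4 → ℝ) (φ : L2) : Prop where
  dilation : ∀ᵐ x : ℝ, φ x = ((√2 : ℝ) : ℂ) * ∑ k : Fin 4, (c k : ℂ) * φ (2 * x - (k : ℕ))
  fourier : ∀ᵐ ξ : ℝ, hat φ ξ = ∏' j : ℕ, m0 c (ξ / 2 ^ (j + 1))

/-- `s₀ = sup {s : φ ∈ H^s}`, as a supremum of a non-empty bounded set of reals. -/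
def IsSobolevExponent (φ : L2) (s₀ : ℝ) : Prop :=
  IsLUB {s : ℝ | MemH s φ} s₀

end Wavelet

end

noncomputable section

namespace Wavelet

open Filter Topology

open scoped SchwartzMap FourierTransform

/-! In half-angle form `|m₀(ξ)|² = cos²(ξ/2) r_v(ξ)`. Multiplying over the dyadic points `ξ/2^j`, `1
≤ j ≤ n`, the cosines telescope to a quotient of sines, so on `(0, 2ⁿπ]` the density `ξ²|φ̂(ξ)|²` is
bounded above, up to a constant, by `sin²(ξ/2) ∏ r_v(ξ/2^j)`. It is bounded below in the same way
when the infinite product has a positive lower bound on `[0, π]`. Folding `[0, 2ⁿπ]` back to `[0,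
π]` turns the integral of this product into `∫ sin²(ξ/2) Tⁿu` (`integral_partialProd`), where `T` is
the transfer operator of `r_v`. It preserves the span of `1` and `cos`, with eigenvalues `1 ±
√(1-v)` there.

For `-8 < v < 1` a nonnegative eigenfunction gives growth `(1+√(1-v))ⁿ` of the dyadic energies,
enough to make the Sobolev energy infinite for some `s < 1`. For `v = 1` the double eigenvalue `1`
has a Jordan block and the growth is linear: the energy is infinite at `s = 1` but finite for every
`s < 1`. At `v = -8` the filter vanishes at `π/3` and the lower bound is lost, but `|m₀|² =
cos²(3ξ/2)` and the telescoping can be done explicitly.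

The admissible filters form a circle in the variables `c₀, c₃`, and `v` is a quadratic function of
`c₀ + c₃` on it. This gives the range `[-8, 1]` and the Daubechies case as the maximum. The scaling
function exists because orthonormality makes `1` a fixed point of the transfer operator of `|m₀|²`,
which bounds the product in `L²`. -/

/-! ### The transfer operator on the span of `1, cos ξ, cos 2ξ` -/

theorem linearIndependent_cosFun : LinearIndependent ℂ cosFun := by
  rw [Fintype.linearIndependent_iff]
  intro a ha
  have hpi := Real.pi_pos
  have h0 := congrArg (fun u : C(I0π, ℂ) ↦ u ⟨0, by constructor <;> linarith⟩) ha
  have h1 := congrArg (fun u : C(I0π, ℂ) ↦ u ⟨Real.pi / 2, by constructor <;> linarith⟩) ha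
  have h2 := congrArg (fun u : C(I0π, ℂ) ↦ u ⟨Real.pi, by constructor <;> linarith⟩) ha
  have e1 : Real.cos (2 * (Real.pi / 2)) = -1 := by
    rw [show 2 * (Real.pi / 2) = Real.pi by ring, Real.cos_pi]
  have e2 : Real.cos (2 * Real.pi) = 1 := Real.cos_two_pi
  simp only [Fin.sum_univ_three, cosFun, ContinuousMap.add_apply, ContinuousMap.smul_apply,
    ContinuousMap.coe_mk, smul_eq_mul, ContinuousMap.zero_apply, Fin.val_zero, Fin.val_one,
    Fin.val_two, Nat.cast_zero, Nat.cast_one, Nat.cast_ofNat, zero_mul, one_mul, mul_zero,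
    Real.cos_zero, Real.cos_pi, Real.cos_pi_div_two, e1, e2, Complex.ofReal_one,
    Complex.ofReal_zero, Complex.ofReal_neg, mul_one] at h0 h1 h2
  intro i
  fin_cases i
  · show a 0 = 0
    linear_combination (1 / 4) * h0 + (1 / 2) * h1 + (1 / 4) * h2
  · show a 1 = 0
    linear_combination (1 / 2) * h0 - (1 / 2) * h2
  · show a 2 = 0
    linear_combination (1 / 4) * h0 - (1 / 2) * h1 + (1 / 4) * h2

theorem r_apply (v ξ : ℝ) :
    r v ξ = -(v / 2) * Real.cos ξ ^ 2 + v / 2 * Real.cos ξ + 1 := rfl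

theorem r_pi_nonneg_iff (v : ℝ) : 0 ≤ r v Real.pi ↔ v ≤ 1 := by
  rw [r_apply, Real.cos_pi]
  constructor <;> intro h <;> linarith

theorem T_cosFun (v : ℝ) (i : Fin 3) :
    T (r v) (cosFun i) = ∑ j : Fin 3, (transferMatrix v i j : ℂ) • cosFun j := by
  ext ξ
  have e1 : Real.cos (ξ : ℝ) = 2 * Real.cos ((ξ : ℝ) / 2) ^ 2 - 1 := by
    rw [← Real.cos_two_mul]; congr 1; ring
  have e2 : Real.cos (2 * (ξ : ℝ)) = 2 * (2 * Real.cos ((ξ : ℝ) / 2) ^ 2 - 1) ^ 2 - 1 := by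
    rw [Real.cos_two_mul, e1]
  have e3 : Real.cos (2 * ((ξ : ℝ) / 2)) = 2 * Real.cos ((ξ : ℝ) / 2) ^ 2 - 1 :=
    Real.cos_two_mul _
  have e4 : Real.cos (2 * (Real.pi - (ξ : ℝ) / 2)) = 2 * Real.cos ((ξ : ℝ) / 2) ^ 2 - 1 := by
    rw [Real.cos_two_mul, Real.cos_pi_sub, neg_sq]
  rw [T_apply]
  fin_cases i <;>
  · simp [Fin.sum_univ_three, cosFun, half, coHalf, r_apply, transferMatrix, Real.cos_pi_sub,
      -Complex.ofReal_cos, -Complex.ofReal_sin, e1, e2, e3, e4]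
    push_cast
    ring

theorem sum_smul_cosFun_eq (a : Fin 3 → ℂ) (ξ : I0π) :
    (∑ i, a i • cosFun i) ξ = ∑ i, a i * cosFun i ξ := by
  simp [Fin.sum_univ_three]

theorem sum_smul_cosFun_eq_zero_iff (a : Fin 3 → ℂ) : ∑ i, a i • cosFun i = 0 ↔ a = 0 := by
  constructor
  · intro h
    funext i
    exact Fintype.linearIndependent_iff.1 linearIndependent_cosFun _ h i
  · rintro rfl
    ext ξ
    rw [sum_smul_cosFun_eq]
    simp

theorem T_sum_cosFun (v : ℝ) (a : Fin 3 → ℂ) :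
    T (r v) (∑ i, a i • cosFun i) =
      ∑ j, (Matrix.vecMul a ((transferMatrix v).map ((↑) : ℝ → ℂ))) j • cosFun j := by
  ext ξ
  simp only [map_sum, map_smul, T_cosFun, Matrix.vecMul, dotProduct, Matrix.map_apply]
  simp only [ContinuousMap.coe_sum, ContinuousMap.coe_smul, Finset.sum_apply, Pi.smul_apply,
    smul_eq_mul, Finset.mul_sum, Finset.sum_mul]
  rw [Finset.sum_comm]
  simp only [mul_assoc]

theorem mem_cosSpan_iff {u : C(I0π, ℂ)} : u ∈ cosSpan ↔ ∃ a : Fin 3 → ℂ, ∑ i, a i • cosFun i = u :=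
  Submodule.mem_span_range_iff_exists_fun ℂ

theorem T_mem_cosSpan (v : ℝ) {u : C(I0π, ℂ)} (hu : u ∈ cosSpan) : T (r v) u ∈ cosSpan := by
  obtain ⟨a, rfl⟩ := mem_cosSpan_iff.1 hu
  exact mem_cosSpan_iff.2 ⟨_, (T_sum_cosFun v a).symm⟩

theorem charpoly_transferMatrix {v : ℝ} (hv : v ≤ 1) :
    (transferMatrix v).charpoly =
      (Polynomial.X - Polynomial.C (1 + √(1 - v))) *
      (Polynomial.X - Polynomial.C (1 - √(1 - v))) *
      (Polynomial.X - Polynomial.C (-v / 4)) := by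
  have hs : √(1 - v) ^ 2 = 1 - v := Real.sq_sqrt (by linarith)
  refine Polynomial.funext fun x ↦ ?_
  rw [Matrix.eval_charpoly, Matrix.det_fin_three]
  simp [transferMatrix, Matrix.scalar_apply, Matrix.diagonal]
  linear_combination (x + v / 4) * hs

/-- Linear independence of the cosines turns the eigenvalue equation into a left-kernel problem (the
matrix lists images by rows), hence into the vanishing of a determinant. -/
theorem isEigenvalueOnSpan_iff {v : ℝ} (hv : v ≤ 1) (μ : ℂ) :
    IsEigenvalueOnSpan (r v) μ ↔
      μ = ((1 + √(1 - v) : ℝ) : ℂ) ∨ μ = ((1 - √(1 - v) : ℝ) : ℂ) ∨ μ = ((-v / 4 : ℝ) : ℂ) := by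
  set M : Matrix (Fin 3) (Fin 3) ℂ := (transferMatrix v).map ((↑) : ℝ → ℂ) with hM
  have hs : ((√(1 - v) : ℝ) : ℂ) ^ 2 = 1 - v := by
    exact_mod_cast Real.sq_sqrt (show 0 ≤ 1 - v by linarith)
  have hsub (a : Fin 3 → ℂ) : T (r v) (∑ i, a i • cosFun i) = μ • ∑ i, a i • cosFun i ↔
      Matrix.vecMul a (M - Matrix.scalar (Fin 3) μ) = 0 := by
    rw [T_sum_cosFun, ← sub_eq_zero, ← sum_smul_cosFun_eq_zero_iff]
    refine Eq.congr ?_ rfl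
    ext ξ
    rw [ContinuousMap.sub_apply, ContinuousMap.smul_apply]
    simp only [sum_smul_cosFun_eq, smul_eq_mul, Finset.mul_sum, ← Finset.sum_sub_distrib]
    refine Finset.sum_congr rfl fun i _ ↦ ?_
    simp [Matrix.vecMul_sub, ← hM]
    ring
  have key : IsEigenvalueOnSpan (r v) μ ↔ ∃ a : Fin 3 → ℂ, a ≠ 0 ∧
      Matrix.vecMul a (M - Matrix.scalar (Fin 3) μ) = 0 := by
    constructor
    · rintro ⟨u, hu, hu0, h⟩
      obtain ⟨a, rfl⟩ := mem_cosSpan_iff.1 hu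
      exact ⟨a, fun h0 ↦ hu0 ((sum_smul_cosFun_eq_zero_iff a).2 h0), (hsub a).1 h⟩
    · rintro ⟨a, ha, h⟩
      exact ⟨_, mem_cosSpan_iff.2 ⟨a, rfl⟩, fun h0 ↦ ha ((sum_smul_cosFun_eq_zero_iff a).1 h0),
        (hsub a).2 h⟩
  have hdet : (M - Matrix.scalar (Fin 3) μ).det =
      -((μ - ((1 + √(1 - v) : ℝ) : ℂ)) * (μ - ((1 - √(1 - v) : ℝ) : ℂ)) *
        (μ - ((-v / 4 : ℝ) : ℂ))) := by
    rw [Matrix.det_fin_three]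
    simp [hM, transferMatrix, Matrix.scalar_apply, Matrix.diagonal]
    linear_combination (-(μ + v / 4)) * hs
  rw [key, Matrix.exists_vecMul_eq_zero_iff, hdet, neg_eq_zero, mul_eq_zero, mul_eq_zero,
    sub_eq_zero, sub_eq_zero, sub_eq_zero, or_assoc]

theorem one_le_spectralRadius {v : ℝ} (hv : v ≤ 1) : 1 ≤ spectralRadius ℂ (T (r v)) := by
  obtain ⟨u, -, hu0, hu⟩ := (isEigenvalueOnSpan_iff hv _).2 (Or.inl rfl)
  have hmem : ((1 + √(1 - v) : ℝ) : ℂ) ∈ spectrum ℂ (T (r v)) := by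
    rw [spectrum.mem_iff]
    intro hunit
    apply hu0
    obtain ⟨S, hS⟩ := hunit.exists_left_inv
    have := congrArg (fun A : C(I0π, ℂ) →L[ℂ] C(I0π, ℂ) ↦ A u) hS
    simp only [mul_apply_eq_comp, sub_apply, hu,
      Algebra.algebraMap_eq_smul_one, smul_apply,
      one_apply_eq_self, sub_self, map_zero] at this
    exact this.symm
  refine le_trans ?_
    (le_iSup₂ (f := fun k (_ : k ∈ spectrum ℂ (T (r v))) ↦ (‖k‖₊ : ENNReal)) _ hmem)
  rw [ENNReal.one_le_coe_iff, ← NNReal.coe_le_coe]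
  simp only [NNReal.coe_one, coe_nnnorm, Complex.norm_real, Real.norm_eq_abs]
  exact le_trans (by linarith [Real.sqrt_nonneg (1 - v)]) (le_abs_self _)

/-! ### The filter as a trigonometric polynomial; its zero at `π` -/

/-- The trigonometric polynomial `∑ₖ dₖ e^{-ikξ}` with complex coefficients. -/
def trigPoly (d : Fin 4 → ℂ) (ξ : ℝ) : ℂ :=
  ∑ k : Fin 4, d k * Complex.exp (-Complex.I * ((k : ℕ) : ℂ) * (ξ : ℂ))

theorem m0_eq_trigPoly (c : Fin 4 → ℝ) :
    m0 c = trigPoly fun k ↦ 1 / (√2 : ℝ) * (c k : ℂ) := by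
  funext ξ
  simp only [m0, trigPoly, Finset.mul_sum, mul_assoc]

theorem hasDerivAt_trigPoly (d : Fin 4 → ℂ) (ξ : ℝ) :
    HasDerivAt (trigPoly d) (trigPoly (fun k ↦ -Complex.I * ((k : ℕ) : ℂ) * d k) ξ) ξ := by
  unfold trigPoly
  refine HasDerivAt.fun_sum fun k _ ↦ ?_
  have h : HasDerivAt (fun x : ℝ ↦ -Complex.I * ((k : ℕ) : ℂ) * (x : ℂ))
      (-Complex.I * ((k : ℕ) : ℂ)) ξ := by
    simpa using (Complex.ofRealCLM.hasDerivAt (x := ξ)).const_mul (-Complex.I * ((k : ℕ) : ℂ))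
  exact (h.cexp.const_mul (d k)).congr_deriv (by ring)

theorem deriv_trigPoly (d : Fin 4 → ℂ) :
    deriv (trigPoly d) = trigPoly (fun k ↦ -Complex.I * ((k : ℕ) : ℂ) * d k) :=
  funext fun ξ ↦ (hasDerivAt_trigPoly d ξ).deriv

theorem analyticAt_trigPoly (d : Fin 4 → ℂ) (ξ : ℝ) : AnalyticAt ℝ (trigPoly d) ξ := by
  unfold trigPoly
  refine Finset.analyticAt_fun_sum _ fun k _ ↦ analyticAt_const.mul ?_
  have h : AnalyticAt ℝ (fun x : ℝ ↦ -Complex.I * ((k : ℕ) : ℂ) * (x : ℂ)) ξ :=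
    analyticAt_const.mul (Complex.ofRealCLM.analyticAt ξ)
  exact (analyticAt_cexp.restrictScalars (𝕜 := ℝ)).comp h

theorem trigPoly_pi (d : Fin 4 → ℂ) : trigPoly d Real.pi = d 0 - d 1 + d 2 - d 3 := by
  have h (k : ℕ) : Complex.exp (-Complex.I * k * Real.pi) = (-1) ^ k := by
    rw [show -Complex.I * k * Real.pi = -(k * (Real.pi * Complex.I)) by ring, Complex.exp_neg,
      Complex.exp_nat_mul, Complex.exp_pi_mul_I, ← inv_pow]
    norm_num
  simp only [trigPoly, h, Fin.sum_univ_four]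
  simp
  ring

theorem continuous_m0 (c : Fin 4 → ℝ) : Continuous (m0 c) := by
  unfold m0
  fun_prop

theorem m0_eq (c : Fin 4 → ℝ) (ξ : ℝ) :
    m0 c ξ = ((1 / √2 * (c 0 + c 1 * Real.cos ξ + c 2 * Real.cos (2 * ξ) +
        c 3 * Real.cos (3 * ξ)) : ℝ) : ℂ) +
      ((-(1 / √2 * (c 1 * Real.sin ξ + c 2 * Real.sin (2 * ξ) +
        c 3 * Real.sin (3 * ξ))) : ℝ) : ℂ) * Complex.I := by
  have h (k : ℕ) : Complex.exp (-Complex.I * k * ξ) =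
      (Real.cos (k * ξ) : ℂ) - (Real.sin (k * ξ) : ℂ) * Complex.I := by
    rw [show -Complex.I * k * ξ = ((-(k * ξ) : ℝ) : ℂ) * Complex.I by push_cast; ring,
      Complex.exp_mul_I, ← Complex.ofReal_cos, ← Complex.ofReal_sin, Real.cos_neg, Real.sin_neg]
    push_cast
    ring
  simp only [m0, h, Fin.sum_univ_four, Fin.val_zero, Fin.val_one, Fin.val_two,
    show ((3 : Fin 4) : ℕ) = 3 from rfl]
  simp only [Nat.cast_zero, Nat.cast_one, Nat.cast_ofNat, zero_mul, one_mul, Real.cos_zero,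
    Real.sin_zero]
  push_cast
  ring

theorem norm_sq_m0 (c : Fin 4 → ℝ) (ξ : ℝ) :
    ‖m0 c ξ‖ ^ 2 = 1 / 2 * (c 0 ^ 2 + c 1 ^ 2 + c 2 ^ 2 + c 3 ^ 2)
      + (c 0 * c 1 + c 1 * c 2 + c 2 * c 3) * Real.cos ξ
      + (c 0 * c 2 + c 1 * c 3) * Real.cos (2 * ξ) + c 0 * c 3 * Real.cos (3 * ξ) := by
  have h2 : (1 / √2) ^ 2 = (1 / 2 : ℝ) := by
    rw [div_pow, Real.sq_sqrt (by norm_num)]; norm_num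
  rw [← Complex.normSq_eq_norm_sq, m0_eq, Complex.normSq_add_mul_I, neg_sq, mul_pow, mul_pow, h2,
    Real.cos_two_mul, Real.cos_three_mul, Real.sin_two_mul, Real.sin_three_mul]
  have hS := Real.sin_sq_add_cos_sq ξ
  generalize Real.sin ξ = S at *
  generalize Real.cos ξ = C at *
  have hS' : S ^ 2 = 1 - C ^ 2 := by linarith
  have h4 : S ^ 4 = (1 - C ^ 2) ^ 2 := by rw [← hS']; ring
  have h6 : S ^ 6 = (1 - C ^ 2) ^ 3 := by rw [← hS']; ring
  ring_nf
  simp only [h4, h6, hS']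
  ring

theorem norm_m0_neg (c : Fin 4 → ℝ) (ξ : ℝ) : ‖m0 c (-ξ)‖ = ‖m0 c ξ‖ := by
  rw [← sq_eq_sq₀ (norm_nonneg _) (norm_nonneg _), norm_sq_m0, norm_sq_m0]
  simp

theorem one_le_vanishingMoments_iff (c : Fin 4 → ℝ) :
    1 ≤ vanishingMoments c ↔ c 0 - c 1 + c 2 - c 3 = 0 := by
  have h2 : ((√2 : ℝ) : ℂ) ≠ 0 := by simp
  rw [vanishingMoments, Order.one_le_iff_ne_zero, m0_eq_trigPoly,
    (analyticAt_trigPoly _ _).analyticOrderAt_ne_zero, trigPoly_pi, ← mul_sub, ← mul_add, ← mul_sub,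
    mul_eq_zero, or_iff_right (one_div_ne_zero h2)]
  norm_cast

/-- In `|m₀(ξ)|² + |m₀(π+ξ)|²` only a constant and a `cos 2ξ` term survive. The values at `0` and
`π/2` separate them; the conditions at `0` and `π` fix the even and odd coefficient sums. -/
theorem isFilter_iff (c : Fin 4 → ℝ) :
    (IsOrthonormalFilter c ∧ 1 ≤ vanishingMoments c) ↔
      c 0 + c 2 = √2 / 2 ∧ c 1 + c 3 = √2 / 2 ∧ c 0 * c 2 + c 1 * c 3 = 0 := by
  have hk : √2 ^ 2 = 2 := Real.sq_sqrt (by norm_num)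
  have hpos : 0 < √2 := by positivity
  have h0 : m0 c 0 = 1 ↔ c 0 + c 1 + c 2 + c 3 = √2 := by
    rw [m0_eq]
    simp only [mul_zero, Real.cos_zero, Real.sin_zero, mul_one, add_zero, neg_zero,
      Complex.ofReal_zero, zero_mul, Complex.ofReal_eq_one]
    rw [one_div, inv_mul_eq_one₀ hpos.ne', eq_comm]
  have hsum (ξ : ℝ) : ‖m0 c ξ‖ ^ 2 + ‖m0 c (Real.pi + ξ)‖ ^ 2 =
      (c 0 ^ 2 + c 1 ^ 2 + c 2 ^ 2 + c 3 ^ 2) +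
        2 * (c 0 * c 2 + c 1 * c 3) * Real.cos (2 * ξ) := by
    have hc : Real.cos (Real.pi + ξ) = -Real.cos ξ := by rw [add_comm, Real.cos_add_pi]
    rw [norm_sq_m0, norm_sq_m0, Real.cos_two_mul, Real.cos_two_mul, Real.cos_three_mul,
      Real.cos_three_mul, hc]
    ring
  rw [one_le_vanishingMoments_iff]
  constructor
  · rintro ⟨⟨h1, h2⟩, h3⟩
    rw [h0] at h1
    have e0 := h2 0
    have e1 := h2 (Real.pi / 2)
    rw [hsum, mul_zero, Real.cos_zero] at e0
    rw [hsum, mul_div_cancel₀ _ two_ne_zero, Real.cos_pi] at e1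
    exact ⟨by linarith, by linarith, by linarith⟩
  · rintro ⟨h1, h2, h3⟩
    refine ⟨⟨h0.2 (by linarith), fun ξ ↦ ?_⟩, by linarith⟩
    rw [hsum, h3, mul_zero, zero_mul, add_zero]
    have e1 : (c 0 + c 2) ^ 2 = 1 / 2 := by rw [h1]; linarith
    have e2 : (c 1 + c 3) ^ 2 = 1 / 2 := by rw [h2]; linarith
    linarith

/-! ### The parameter `v` of a filter -/

theorem hasParameter_iff {c : Fin 4 → ℝ} (hc : IsOrthonormalFilter c)
    (hm : 1 ≤ vanishingMoments c) (v : ℝ) : HasParameter c v ↔ v = -16 * (c 0 * c 3) := by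
  obtain ⟨h1, h2, h3⟩ := (isFilter_iff c).1 ⟨hc, hm⟩
  have hk : √2 ^ 2 = 2 := Real.sq_sqrt (by norm_num)
  have e1 : (c 0 + c 2) ^ 2 = 1 / 2 := by rw [h1]; linarith
  have e2 : (c 1 + c 3) ^ 2 = 1 / 2 := by rw [h2]; linarith
  have e3 : (c 0 + c 2) * (c 1 + c 3) = 1 / 2 := by rw [h1, h2]; linarith
  have hform (ξ : ℝ) : ‖m0 c ξ‖ ^ 2 =
      1 / 2 + (1 / 2 - c 0 * c 3) * Real.cos ξ + c 0 * c 3 * Real.cos (3 * ξ) := by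
    rw [norm_sq_m0]
    linear_combination (1 / 2) * e1 + (1 / 2) * e2 - h3 + Real.cos ξ * e3
      + Real.cos (2 * ξ) * h3
  constructor
  · intro h
    have := h Real.pi
    -- At `0` and at `π` the parameter cancels from the formula; at `π/3` the two cosines are `1/2`
    -- and `-1`, which determines it.
    have h' := h (Real.pi / 3)
    rw [hform, mul_div_cancel₀ _ three_ne_zero, Real.cos_pi, Real.cos_pi_div_three] at h'
    linarith
  · rintro rfl ξ
    rw [hform]
    ring

theorem existsUnique_hasParameter {c : Fin 4 → ℝ} (hc : IsOrthonormalFilter c)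
    (hm : 1 ≤ vanishingMoments c) : ∃! v : ℝ, HasParameter c v :=
  ⟨_, (hasParameter_iff hc hm _).2 rfl, fun _ h ↦ (hasParameter_iff hc hm _).1 h⟩

theorem HasParameter.norm_sq_m0_eq {c : Fin 4 → ℝ} {v : ℝ} (h : HasParameter c v) (ξ : ℝ) :
    ‖m0 c ξ‖ ^ 2 = (1 + Real.cos ξ) / 2 * r v ξ := by
  rw [h ξ, r_apply, Real.cos_three_mul]
  ring

/-- The parameter is a quadratic function of `c₀ + c₃`. -/
theorem HasParameter.eq_one_sub {c : Fin 4 → ℝ} (hc : IsOrthonormalFilter c)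
    (hm : 1 ≤ vanishingMoments c) {v : ℝ} (h : HasParameter c v) :
    v = 1 - 8 * (c 0 + c 3 - √2 / 4) ^ 2 := by
  rw [(hasParameter_iff hc hm v).1 h]
  obtain ⟨h1, h2, h3⟩ := (isFilter_iff c).1 ⟨hc, hm⟩
  have hk : √2 ^ 2 = 2 := Real.sq_sqrt (by norm_num)
  rw [show c 2 = √2 / 2 - c 0 by linarith, show c 1 = √2 / 2 - c 3 by linarith] at h3
  linear_combination (-8) * h3 + (1 / 2) * hk

theorem HasParameter.le_one {c : Fin 4 → ℝ} (hc : IsOrthonormalFilter c)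
    (hm : 1 ≤ vanishingMoments c) {v : ℝ} (h : HasParameter c v) : v ≤ 1 := by
  rw [h.eq_one_sub hc hm]
  nlinarith [sq_nonneg (c 0 + c 3 - √2 / 4)]

theorem HasParameter.neg_eight_le {c : Fin 4 → ℝ} {v : ℝ} (h : HasParameter c v) : -8 ≤ v := by
  have := h.norm_sq_m0_eq (Real.pi / 3)
  rw [r_apply, Real.cos_pi_div_three] at this
  have h0 := sq_nonneg ‖m0 c (Real.pi / 3)‖
  rw [this] at h0
  linarith

/-- With `x = cos ξ`, `r_v` is affine in `v`, equal to `(2x-1)²` at `v = -8` and to `(2-x)(1+x)/2`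
at `v = 1`. Both are nonnegative on `[-1, 1]`; their zeros `x = 1/2` and `x = -1` make the bounds
sharp. -/
theorem r_nonneg_iff (v : ℝ) : (∀ ξ : ℝ, 0 ≤ r v ξ) ↔ -8 ≤ v ∧ v ≤ 1 := by
  constructor
  · intro h
    have h1 := h (Real.pi / 3)
    have h2 := h Real.pi
    rw [r_apply, Real.cos_pi_div_three] at h1
    rw [r_apply, Real.cos_pi] at h2
    constructor <;> linarith
  · rintro ⟨h1, h2⟩ ξ
    rw [r_apply]
    have a := Real.neg_one_le_cos ξ
    have b := Real.cos_le_one ξ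
    have ab : 0 ≤ (1 - Real.cos ξ) * (Real.cos ξ + 1) :=
      mul_nonneg (by linarith) (by linarith)
    nlinarith [sq_nonneg (Real.cos ξ - 1 / 2), mul_nonneg ab (by linarith : 0 ≤ v + 8),
      mul_nonneg (sq_nonneg (Real.cos ξ - 1 / 2)) (by linarith : 0 ≤ 1 - v),
      mul_nonneg (sq_nonneg (Real.cos ξ - 1 / 2)) (by linarith : 0 ≤ v + 8)]

theorem exists_hasParameter_iff (v : ℝ) :
    (∃ c : Fin 4 → ℝ, IsOrthonormalFilter c ∧ 1 ≤ vanishingMoments c ∧ HasParameter c v) ↔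
      ∀ ξ : ℝ, 0 ≤ r v ξ := by
  rw [r_nonneg_iff]
  constructor
  · rintro ⟨c, hc, hm, h⟩
    exact ⟨h.neg_eight_le, h.le_one hc hm⟩
  · rintro ⟨h1, h2⟩
    have hk : √2 ^ 2 = 2 := Real.sq_sqrt (by norm_num)
    have hk0 : 0 < √2 := by positivity
    obtain ⟨t, ht0, ht⟩ : ∃ t : ℝ, 0 ≤ t ∧ t ^ 2 = (1 - v) / 8 :=
      ⟨_, Real.sqrt_nonneg _, Real.sq_sqrt (by linarith)⟩
    -- This is where `v ≥ -8` enters: it gives `S ≤ √2` below, so that `S(√2 - S)` has a real square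
    -- root.
    have htk : t ≤ 3 * √2 / 4 := by
      refine abs_le_of_sq_le_sq' ?_ (by positivity) |>.2
      rw [ht]; nlinarith
    obtain ⟨S, hS⟩ : ∃ S : ℝ, S = √2 / 4 + t := ⟨_, rfl⟩
    have hd : 0 ≤ S * (√2 - S) := mul_nonneg (by rw [hS]; positivity) (by linarith)
    obtain ⟨d, hd0, hd⟩ : ∃ d : ℝ, 0 ≤ d ∧ d ^ 2 = S * (√2 - S) :=
      ⟨_, Real.sqrt_nonneg _, Real.sq_sqrt hd⟩
    have hSt : (S - √2 / 4) ^ 2 = (1 - v) / 8 := by rw [hS, ← ht]; ring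
    -- Here `S = c₀ + c₃` and `d = c₀ - c₃`. The choice of `S` solves `v = 1 - 8(S - √2/4)²`, and
    -- `d² = S(√2 - S)` is the circle `c₀c₂ + c₁c₃ = 0`.
    let c : Fin 4 → ℝ := ![(S + d) / 2, √2 / 2 - (S - d) / 2, √2 / 2 - (S + d) / 2, (S - d) / 2]
    have hf : IsOrthonormalFilter c ∧ 1 ≤ vanishingMoments c := by
      rw [isFilter_iff]
      refine ⟨?_, ?_, ?_⟩
      · simp [c]
      · simp [c]
      · simp [c]
        linear_combination (-1 / 2) * hd
    refine ⟨c, hf.1, hf.2, (hasParameter_iff hf.1 hf.2 v).2 ?_⟩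
    simp [c]
    linear_combination (-4) * hd + 8 * hSt - (1 / 2) * hk

/-- Given the filter conditions, the first derivative at `π` vanishes exactly when `c₀ + c₃ = √2/4`,
the point where the quadratic expression for `v` takes its maximum `1`. A zero of order three would
force `c₀ = c₃ = √2/8`, which is off the circle. -/
theorem eq_one_iff_isDaubechiesFilter {c : Fin 4 → ℝ} (hc : IsOrthonormalFilter c)
    (hm : 1 ≤ vanishingMoments c) {v : ℝ} (h : HasParameter c v) :
    v = 1 ↔ IsDaubechiesFilter c := by
  have hk : √2 ^ 2 = 2 := Real.sq_sqrt (by norm_num)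
  have hk1 : ((√2 : ℝ) : ℂ) ≠ 0 := by simp
  obtain ⟨h1, h2, h3⟩ := (isFilter_iff c).1 ⟨hc, hm⟩
  have hv := h.eq_one_sub hc hm
  have key : IsDaubechiesFilter c ↔
      (c 1 - 2 * c 2 + 3 * c 3 = 0) ∧ (c 1 - 4 * c 2 + 9 * c 3 ≠ 0) := by
    rw [IsDaubechiesFilter, and_iff_right hc, vanishingMoments, m0_eq_trigPoly]
    have h2' : (2 : ℕ∞) = ((2 : ℕ) : ℕ∞) := rfl
    have hall (p : ℕ → Prop) : (∀ k < 2, p k) ↔ p 0 ∧ p 1 :=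
      ⟨fun h ↦ ⟨h 0 (by norm_num), h 1 (by norm_num)⟩, fun h k hk ↦ by
        interval_cases k
        exacts [h.1, h.2]⟩
    rw [h2', analyticOrderAt_eq_nat_iff_iteratedDeriv_eq_zero (analyticAt_trigPoly _ _), hall,
      show iteratedDeriv 2 _ = deriv (iteratedDeriv 1 _) from iteratedDeriv_succ, iteratedDeriv_one,
      iteratedDeriv_zero, deriv_trigPoly, deriv_trigPoly,
      trigPoly_pi, trigPoly_pi, trigPoly_pi]
    have f0 : 1 / ((√2 : ℝ) : ℂ) * (c 0 : ℂ) - 1 / ((√2 : ℝ) : ℂ) * (c 1 : ℂ)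
        + 1 / ((√2 : ℝ) : ℂ) * (c 2 : ℂ) - 1 / ((√2 : ℝ) : ℂ) * (c 3 : ℂ) = 0 := by
      have : ((c 0 : ℂ) - c 1 + c 2 - c 3) = 0 := by
        norm_cast
        linarith
      linear_combination (1 / ((√2 : ℝ) : ℂ)) * this
    rw [and_iff_right f0]
    refine and_congr ?_ (not_congr ?_)
    · rw [show _ - _ + _ - _ = (1 / ((√2 : ℝ) : ℂ) * Complex.I) *
        ((c 1 - 2 * c 2 + 3 * c 3 : ℝ) : ℂ) by
          simp; ring, mul_eq_zero,
        or_iff_right (mul_ne_zero (one_div_ne_zero hk1) Complex.I_ne_zero), Complex.ofReal_eq_zero]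
    · rw [show _ - _ + _ - _ = (1 / ((√2 : ℝ) : ℂ)) *
        ((c 1 - 4 * c 2 + 9 * c 3 : ℝ) : ℂ) by
          simp; ring_nf; simp [Complex.I_sq]; ring, mul_eq_zero,
        or_iff_right (one_div_ne_zero hk1), Complex.ofReal_eq_zero]
  have e2 : c 2 = √2 / 2 - c 0 := by linarith
  have e1 : c 1 = √2 / 2 - c 3 := by linarith
  rw [key, e1, e2]
  rw [e1, e2] at h3
  constructor
  · rintro rfl
    have hS : c 0 + c 3 = √2 / 4 := by
      have : (c 0 + c 3 - √2 / 4) ^ 2 = 0 := by linarith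
      linarith [pow_eq_zero_iff two_ne_zero |>.1 this]
    refine ⟨by linarith, fun h' ↦ ?_⟩
    have h4 : c 3 = √2 / 8 := by linarith
    have h5 : c 0 = √2 / 8 := by linarith
    rw [h4, h5] at h3
    nlinarith
  · rintro ⟨h', -⟩
    rw [hv, show c 0 + c 3 - √2 / 4 = 0 by linarith]
    norm_num

/-! ### The infinite product -/

/-- The infinite product `∏_{j ≥ 1} m₀(2^{-j} ξ)`. -/
def scalingProduct (c : Fin 4 → ℝ) (ξ : ℝ) : ℂ := ∏' j : ℕ, m0 c (ξ / 2 ^ (j + 1))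

theorem norm_trigPoly_le (d : Fin 4 → ℂ) (ξ : ℝ) : ‖trigPoly d ξ‖ ≤ ∑ k, ‖d k‖ := by
  refine (norm_sum_le _ _).trans (Finset.sum_le_sum fun k _ ↦ ?_)
  rw [norm_mul,
    show -Complex.I * ((k : ℕ) : ℂ) * (ξ : ℂ) = ((-((k : ℕ) * ξ) : ℝ) : ℂ) * Complex.I by
    push_cast; ring, Complex.norm_exp_ofReal_mul_I, mul_one]

theorem exists_norm_m0_sub_one_le {c : Fin 4 → ℝ} (hc : m0 c 0 = 1) :
    ∃ K : ℝ, 0 ≤ K ∧ ∀ ξ, ‖m0 c ξ - 1‖ ≤ K * |ξ| := by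
  refine ⟨∑ k : Fin 4, ‖-Complex.I * ((k : ℕ) : ℂ) * (1 / (√2 : ℝ) * (c k : ℂ))‖,
    Finset.sum_nonneg fun _ _ ↦ norm_nonneg _, fun ξ ↦ ?_⟩
  have := convex_univ.norm_image_sub_le_of_norm_hasDerivWithin_le
    (f := trigPoly fun k ↦ 1 / (√2 : ℝ) * (c k : ℂ))
    (fun x _ ↦ (hasDerivAt_trigPoly _ x).hasDerivWithinAt)
    (fun x _ ↦ norm_trigPoly_le _ x) (Set.mem_univ 0) (Set.mem_univ ξ)
  rwa [← m0_eq_trigPoly, hc, sub_zero] at this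

theorem summable_norm_m0_sub_one {c : Fin 4 → ℝ} (hc : m0 c 0 = 1) (ξ : ℝ) :
    Summable fun j : ℕ ↦ ‖m0 c (ξ / 2 ^ (j + 1)) - 1‖ := by
  obtain ⟨K, hK0, hK⟩ := exists_norm_m0_sub_one_le hc
  refine Summable.of_nonneg_of_le (fun _ ↦ norm_nonneg _) (fun j ↦ (hK _).trans_eq ?_)
    (summable_geometric_two' (K * |ξ|))
  rw [abs_div, abs_of_pos (by positivity : (0 : ℝ) < 2 ^ (j + 1)), pow_succ]
  field_simp

theorem multipliable_m0 {c : Fin 4 → ℝ} (hc : m0 c 0 = 1) (ξ : ℝ) :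
    Multipliable fun j : ℕ ↦ m0 c (ξ / 2 ^ (j + 1)) := by
  simpa using multipliable_one_add_of_summable (summable_norm_m0_sub_one hc ξ)

theorem tendsto_prod_m0 {c : Fin 4 → ℝ} (hc : m0 c 0 = 1) (ξ : ℝ) :
    Tendsto (fun n ↦ ∏ j ∈ Finset.range n, m0 c (ξ / 2 ^ (j + 1))) atTop
      (𝓝 (scalingProduct c ξ)) :=
  (multipliable_m0 hc ξ).hasProd.tendsto_prod_nat

theorem scalingProduct_eq {c : Fin 4 → ℝ} (hc : m0 c 0 = 1) (ξ : ℝ) (n : ℕ) :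
    scalingProduct c ξ =
      (∏ j ∈ Finset.range n, m0 c (ξ / 2 ^ (j + 1))) * scalingProduct c (ξ / 2 ^ n) := by
  refine tendsto_nhds_unique ((tendsto_prod_m0 hc ξ).comp (tendsto_add_atTop_nat n)) ?_
  refine ((tendsto_prod_m0 hc (ξ / 2 ^ n)).const_mul _).congr fun k ↦ ?_
  rw [Function.comp_apply, add_comm k n, Finset.prod_range_add]
  congr 1
  refine Finset.prod_congr rfl fun j _ ↦ ?_
  rw [div_div, ← pow_add, add_assoc]

theorem norm_m0_le_one {c : Fin 4 → ℝ} (hc : IsOrthonormalFilter c) (ξ : ℝ) : ‖m0 c ξ‖ ≤ 1 := by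
  have := hc.ortho ξ
  refine abs_le_of_sq_le_sq' (a := ‖m0 c ξ‖) (b := 1) ?_ zero_le_one |>.2
  nlinarith [sq_nonneg ‖m0 c (Real.pi + ξ)‖]

theorem norm_scalingProduct_le_one {c : Fin 4 → ℝ} (hc : IsOrthonormalFilter c) (ξ : ℝ) :
    ‖scalingProduct c ξ‖ ≤ 1 := by
  refine le_of_tendsto (tendsto_prod_m0 hc.map_zero ξ).norm (Eventually.of_forall fun n ↦ ?_)
  rw [norm_prod]
  exact Finset.prod_le_one (fun _ _ ↦ norm_nonneg _) fun _ _ ↦ norm_m0_le_one hc _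

theorem norm_scalingProduct_neg {c : Fin 4 → ℝ} (hc : m0 c 0 = 1) (ξ : ℝ) :
    ‖scalingProduct c (-ξ)‖ = ‖scalingProduct c ξ‖ := by
  refine tendsto_nhds_unique (tendsto_prod_m0 hc (-ξ)).norm
    ((tendsto_prod_m0 hc ξ).norm.congr fun n ↦ ?_)
  rw [norm_prod, norm_prod]
  exact Finset.prod_congr rfl fun j _ ↦ by rw [neg_div, norm_m0_neg]

theorem measurable_scalingProduct {c : Fin 4 → ℝ} (hc : m0 c 0 = 1) :
    Measurable (scalingProduct c) := by
  refine measurable_of_tendsto_metrizable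
    (f := fun n ξ ↦ ∏ j ∈ Finset.range n, m0 c (ξ / 2 ^ (j + 1))) (fun n ↦ ?_)
    (tendsto_pi_nhds.2 (tendsto_prod_m0 hc))
  refine Finset.measurable_fun_prod _ fun j _ ↦ ?_
  exact (continuous_m0 c).measurable.comp (measurable_id.div_const _)

theorem tendsto_scalingProduct_zero {c : Fin 4 → ℝ} (hc : m0 c 0 = 1) :
    Tendsto (scalingProduct c) (𝓝 0) (𝓝 1) := by
  obtain ⟨K, hK0, hK⟩ := exists_norm_m0_sub_one_le hc
  have hb (ξ : ℝ) : ‖scalingProduct c ξ - 1‖ ≤ Real.exp (K * |ξ|) - 1 := by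
    refine le_of_tendsto ((tendsto_prod_m0 hc ξ).sub_const 1).norm
      (Eventually.of_forall fun n ↦ ?_)
    have h := Finset.norm_prod_one_add_sub_one_le (Finset.range n)
      fun j ↦ m0 c (ξ / 2 ^ (j + 1)) - 1
    simp only [add_sub_cancel] at h
    refine h.trans (sub_le_sub_right (Real.exp_le_exp.2 ?_) _)
    calc ∑ j ∈ Finset.range n, ‖m0 c (ξ / 2 ^ (j + 1)) - 1‖
        ≤ ∑ j ∈ Finset.range n, K * |ξ| / 2 / 2 ^ j := by
          refine Finset.sum_le_sum fun j _ ↦ (hK _).trans_eq ?_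
          rw [abs_div, abs_of_pos (by positivity : (0 : ℝ) < 2 ^ (j + 1)), pow_succ]
          field_simp
      _ ≤ ∑' j : ℕ, K * |ξ| / 2 / 2 ^ j :=
          (summable_geometric_two' (K * |ξ|)).sum_le_tsum _ fun _ _ ↦ by positivity
      _ = K * |ξ| := tsum_geometric_two' _
  rw [tendsto_iff_norm_sub_tendsto_zero]
  refine squeeze_zero (fun _ ↦ norm_nonneg _) hb ?_
  have : Continuous fun ξ : ℝ ↦ Real.exp (K * |ξ|) - 1 := by fun_prop
  simpa using this.tendsto 0

/-- If `m₀` has no zeros in `[0, π/2]`, then `∏_{j ≥ 1} m₀(2^{-j} ξ)` is bounded away from zero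
on `[0, π]`. -/
theorem exists_le_norm_scalingProduct {c : Fin 4 → ℝ} (hc : m0 c 0 = 1)
    (h0 : ∀ ξ ∈ Set.Icc 0 (Real.pi / 2), m0 c ξ ≠ 0) :
    ∃ δ : ℝ, 0 < δ ∧ ∀ ξ ∈ Set.Icc 0 Real.pi, δ ≤ ‖scalingProduct c ξ‖ ^ 2 := by
  have hev : ∀ᶠ ξ in 𝓝 (0 : ℝ), 1 / 2 < ‖scalingProduct c ξ‖ :=
    (tendsto_scalingProduct_zero hc).norm.eventually_const_lt (by norm_num)
  obtain ⟨ε, hε, hball⟩ := Metric.eventually_nhds_iff.1 hev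
  -- For this `n` the tail of the product is evaluated within `ε` of `0`, where its modulus exceeds
  -- `1/2`. The first `n` factors are taken at points of `[0, π/2]`, so compactness bounds them
  -- below.
  obtain ⟨n, hn⟩ := pow_unbounded_of_one_lt (Real.pi / ε) one_lt_two
  let p (ξ : ℝ) : ℝ := ‖∏ j ∈ Finset.range n, m0 c (ξ / 2 ^ (j + 1))‖
  have hp : Continuous p := by
    refine (continuous_finsetProd _ fun j _ ↦ ?_).norm
    exact (continuous_m0 c).comp (continuous_id.div_const _)
  obtain ⟨ξ₀, hξ₀, hmin⟩ := isCompact_Icc.exists_isMinOn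
    (Set.nonempty_Icc.2 Real.pi_pos.le) hp.continuousOn
  have hpos : 0 < p ξ₀ := by
    refine norm_pos_iff.2 (Finset.prod_ne_zero_iff.2 fun j _ ↦ h0 _ ⟨?_, ?_⟩)
    · exact div_nonneg hξ₀.1 (by positivity)
    · have : (2 : ℝ) ≤ 2 ^ (j + 1) := le_self_pow₀ one_le_two (by omega)
      exact (div_le_div_of_nonneg_left hξ₀.1 two_pos this).trans (by linarith [hξ₀.2])
  refine ⟨(p ξ₀ * (1 / 2)) ^ 2, by positivity, fun ξ hξ ↦ ?_⟩
  rw [scalingProduct_eq hc ξ n, norm_mul]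
  refine pow_le_pow_left₀ (by positivity) (mul_le_mul (hmin hξ) (hball ?_).le (by norm_num)
    (norm_nonneg _)) 2
  rw [Real.dist_0_eq_abs, abs_of_nonneg (div_nonneg hξ.1 (by positivity)),
    div_lt_iff₀ (by positivity)]
  rw [div_lt_iff₀ hε] at hn
  linarith [hξ.2]

/-! ### Iterated transfer operators and integrals of partial products -/

/-- The transfer operator of a mask `q`, acting on functions on the line. -/
def transfer (q u : ℝ → ℝ) (x : ℝ) : ℝ :=
  q (x / 2) * u (x / 2) + q (Real.pi - x / 2) * u (Real.pi - x / 2)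

/-- The partial product `∏_{1 ≤ j ≤ n} q(2^{-j} ξ)`. -/
def partialProd (q : ℝ → ℝ) (n : ℕ) (ξ : ℝ) : ℝ := ∏ j ∈ Finset.range n, q (ξ / 2 ^ (j + 1))

theorem continuous_transfer {q u : ℝ → ℝ} (hq : Continuous q) (hu : Continuous u) :
    Continuous (transfer q u) := by
  unfold transfer
  fun_prop

theorem continuous_partialProd {q : ℝ → ℝ} (hq : Continuous q) (n : ℕ) :
    Continuous (partialProd q n) := by
  unfold partialProd
  fun_prop

theorem partialProd_nonneg {q : ℝ → ℝ} (hq : ∀ x, 0 ≤ q x) (n : ℕ) (ξ : ℝ) :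
    0 ≤ partialProd q n ξ :=
  Finset.prod_nonneg fun _ _ ↦ hq _

theorem apply_two_pow_mul_pi_sub {q : ℝ → ℝ} (heven : ∀ x, q (-x) = q x)
    (hper : Function.Periodic q (2 * Real.pi)) (n : ℕ) (x : ℝ) :
    q (2 ^ (n + 1) * Real.pi - x) = q x := by
  have := hper.nat_mul_sub_eq (2 ^ n) (x := x)
  rw [← heven x, ← this]
  congr 1
  push_cast
  ring

/-- The reflection `ξ ↦ 2^(n+1)π - ξ` folds the upper half of the interval onto the lower one. By
evenness and periodicity it fixes `w` and the first `n` factors; in the last factor and in `u` it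
replaces `x/2` by `π - x/2`, which produces the second term of the operator. -/
theorem integral_transfer_step {q w u : ℝ → ℝ} (hq : Continuous q) (hw : Continuous w)
    (hu : Continuous u) (hqe : ∀ x, q (-x) = q x) (hqp : Function.Periodic q (2 * Real.pi))
    (hwe : ∀ x, w (-x) = w x) (hwp : Function.Periodic w (2 * Real.pi)) (n : ℕ) :
    ∫ ξ in (0 : ℝ)..2 ^ (n + 1) * Real.pi, w ξ * partialProd q (n + 1) ξ * u (ξ / 2 ^ (n + 1)) =
      ∫ ξ in (0 : ℝ)..2 ^ n * Real.pi, w ξ * partialProd q n ξ * transfer q u (ξ / 2 ^ n) := by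
  have hP (k : ℕ) := continuous_partialProd hq k
  set f : ℝ → ℝ := fun ξ ↦ w ξ * partialProd q (n + 1) ξ * u (ξ / 2 ^ (n + 1)) with hf
  have hfc : Continuous f := by
    have := hP (n + 1)
    fun_prop
  have hsplit := intervalIntegral.integral_add_adjacent_intervals
    (hfc.intervalIntegrable 0 (2 ^ n * Real.pi) (μ := volume))
    (hfc.intervalIntegrable (2 ^ n * Real.pi) (2 ^ (n + 1) * Real.pi))
  have hrefl := intervalIntegral.integral_comp_sub_left (a := 0) (b := 2 ^ n * Real.pi) f
    (2 ^ (n + 1) * Real.pi)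
  rw [sub_zero, show (2 : ℝ) ^ (n + 1) * Real.pi - 2 ^ n * Real.pi = 2 ^ n * Real.pi by ring]
    at hrefl
  rw [← hsplit, ← hrefl, ← intervalIntegral.integral_add (hfc.intervalIntegrable _ _)
    (Continuous.intervalIntegrable (by fun_prop) _ _)]
  refine intervalIntegral.integral_congr fun ξ _ ↦ ?_
  have h1 : partialProd q n (2 ^ (n + 1) * Real.pi - ξ) = partialProd q n ξ := by
    refine Finset.prod_congr rfl fun j hj ↦ ?_
    have hj := Finset.mem_range.1 hj
    obtain ⟨k, rfl⟩ : ∃ k, n = j + 1 + k := ⟨n - (j + 1), by omega⟩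
    rw [← apply_two_pow_mul_pi_sub hqe hqp k]
    congr 1
    have : (2 : ℝ) ^ (j + 1 + k + 1) * Real.pi / 2 ^ (j + 1) = 2 ^ (k + 1) * Real.pi := by
      rw [add_assoc (j + 1), pow_add _ (j + 1)]
      field_simp
    rw [sub_div, this, sub_sub_cancel]
  have h2 : (2 ^ (n + 1) * Real.pi - ξ) / 2 ^ (n + 1) = Real.pi - ξ / 2 ^ (n + 1) := by
    field_simp
  have h3 : ξ / 2 ^ n / 2 = ξ / 2 ^ (n + 1) := by rw [div_div, pow_succ]
  have hsucc (x : ℝ) : partialProd q (n + 1) x = partialProd q n x * q (x / 2 ^ (n + 1)) :=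
    Finset.prod_range_succ _ _
  simp only [hf, hsucc, h1, h2, transfer, h3, apply_two_pow_mul_pi_sub hwe hwp]
  ring

/-- Iterating the transfer operator unfolds the integral over `[0, π]` to `[0, 2ⁿ π]`. -/
theorem integral_partialProd {q w u : ℝ → ℝ} (hq : Continuous q) (hw : Continuous w)
    (hu : Continuous u) (hqe : ∀ x, q (-x) = q x) (hqp : Function.Periodic q (2 * Real.pi))
    (hwe : ∀ x, w (-x) = w x) (hwp : Function.Periodic w (2 * Real.pi)) (n : ℕ) :
    ∫ ξ in (0 : ℝ)..2 ^ n * Real.pi, w ξ * partialProd q n ξ * u (ξ / 2 ^ n) =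
      ∫ ξ in (0 : ℝ)..Real.pi, w ξ * (transfer q)^[n] u ξ := by
  induction n generalizing u with
  | zero => simp [partialProd]
  | succ n ih =>
    rw [integral_transfer_step hq hw hu hqe hqp hwe hwp, ih (continuous_transfer hq hu),
      Function.iterate_succ_apply]

theorem r_even (v x : ℝ) : r v (-x) = r v x := by simp [r_apply]

theorem r_periodic (v : ℝ) : Function.Periodic (r v) (2 * Real.pi) := fun x ↦ by
  simp [r_apply]

theorem sin_half_sq (x : ℝ) : Real.sin (x / 2) ^ 2 = (1 - Real.cos x) / 2 := by
  rw [Real.sin_sq_eq_half_sub, mul_div_cancel₀ _ two_ne_zero]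
  ring

theorem cos_half_sq (x : ℝ) : Real.cos (x / 2) ^ 2 = (1 + Real.cos x) / 2 := by
  rw [Real.cos_sq, mul_div_cancel₀ _ two_ne_zero]
  ring

theorem transfer_r_cos (v A B x : ℝ) :
    transfer (r v) (fun y ↦ A + B * Real.cos y) x =
      (2 - v / 2) * A + (v / 2) * B + (v / 2 * B - v / 2 * A) * Real.cos x := by
  have h : Real.cos x = 2 * Real.cos (x / 2) ^ 2 - 1 := by
    rw [← Real.cos_two_mul, mul_div_cancel₀ _ two_ne_zero]
  rw [transfer, r_apply, r_apply, Real.cos_pi_sub, h]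
  ring

theorem integral_sin_half_sq_mul (A B : ℝ) :
    ∫ ξ in (0 : ℝ)..Real.pi, Real.sin (ξ / 2) ^ 2 * (A + B * Real.cos ξ) =
      Real.pi / 2 * (A - B / 2) := by
  have h (ξ : ℝ) : Real.sin (ξ / 2) ^ 2 * (A + B * Real.cos ξ) =
      A / 2 + (B - A) / 2 * Real.cos ξ - B / 2 * Real.cos ξ ^ 2 := by
    rw [sin_half_sq]; ring
  simp_rw [h]
  rw [intervalIntegral.integral_sub, intervalIntegral.integral_add,
    intervalIntegral.integral_const_mul, intervalIntegral.integral_const_mul, integral_cos,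
    integral_cos_sq]
  · simp
    ring
  all_goals exact Continuous.intervalIntegrable (by fun_prop) _ _

theorem integral_sin_half_sq_partialProd {v : ℝ} {u : ℝ → ℝ} (hu : Continuous u) (n : ℕ) :
    ∫ ξ in (0 : ℝ)..2 ^ n * Real.pi,
        Real.sin (ξ / 2) ^ 2 * partialProd (r v) n ξ * u (ξ / 2 ^ n) =
      ∫ ξ in (0 : ℝ)..Real.pi, Real.sin (ξ / 2) ^ 2 * (transfer (r v))^[n] u ξ := by
  refine integral_partialProd (r v).continuous (by fun_prop) hu (r_even v) (r_periodic v)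
    (fun x ↦ ?_) (fun x ↦ ?_) n
  · simp only [sin_half_sq, Real.cos_neg]
  · simp only [sin_half_sq, Real.cos_add_two_pi]

/-- The eigenfunction for the eigenvalue `1 + √(1 - v)`. -/
theorem integral_partialProd_eigenfunction {v : ℝ} (hv : v ≤ 1) (n : ℕ) :
    ∫ ξ in (0 : ℝ)..2 ^ n * Real.pi, Real.sin (ξ / 2) ^ 2 * partialProd (r v) n ξ *
        ((4 * (1 + √(1 - v)) - 2 * v) + (-(2 * v)) * Real.cos (ξ / 2 ^ n)) =
      (1 + √(1 - v)) ^ n * (Real.pi / 2 * (4 * (1 + √(1 - v)) - v)) := by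
  have hs : √(1 - v) ^ 2 = 1 - v := Real.sq_sqrt (by linarith)
  set l := 1 + √(1 - v) with hl
  -- The characteristic equation on the span of `1` and `cos`.
  have hl2 : l ^ 2 = 2 * l - v := by rw [hl]; linear_combination hs
  rw [integral_sin_half_sq_partialProd (u := fun y ↦ (4 * l - 2 * v) + (-(2 * v)) * Real.cos y)
    (by fun_prop)]
  have hiter : (transfer (r v))^[n] (fun y ↦ (4 * l - 2 * v) + (-(2 * v)) * Real.cos y) =
      fun y ↦ l ^ n * (4 * l - 2 * v) + (l ^ n * (-(2 * v))) * Real.cos y := by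
    induction n with
    | zero => simp
    | succ n ih =>
      rw [Function.iterate_succ_apply', ih]
      funext x
      rw [transfer_r_cos]
      linear_combination (-(4 * l ^ n)) * hl2
  rw [hiter, integral_sin_half_sq_mul]
  ring

/-- At `v = 1` the two eigenvalues on the span of `1` and `cos` coincide at `1` in a Jordan block,
so the iterates of the constant `1` grow linearly. -/
theorem integral_partialProd_r_one (n : ℕ) :
    ∫ ξ in (0 : ℝ)..2 ^ n * Real.pi, Real.sin (ξ / 2) ^ 2 * partialProd (r 1) n ξ =
      Real.pi / 2 + 3 * Real.pi / 8 * n := by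
  have hiter : (transfer (r 1))^[n] (fun _ ↦ (1 : ℝ)) =
      fun y ↦ (1 + (n : ℝ) / 2) + (-(n : ℝ) / 2) * Real.cos y := by
    induction n with
    | zero => simp
    | succ n ih =>
      rw [Function.iterate_succ_apply', ih]
      funext x
      rw [transfer_r_cos]
      push_cast
      ring
  have h := integral_sin_half_sq_partialProd (v := 1) (u := fun _ ↦ (1 : ℝ)) continuous_const n
  simp only [mul_one] at h
  rw [h]
  rw [hiter, integral_sin_half_sq_mul]
  ring

/-- Orthonormality says that the constant `1` is fixed by the transfer operator of `|m₀|²`;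
unfolding then costs nothing. -/
theorem integral_partialProd_norm_sq_m0 {c : Fin 4 → ℝ} (hc : IsOrthonormalFilter c) (n : ℕ) :
    ∫ ξ in (0 : ℝ)..2 ^ n * Real.pi, partialProd (fun x ↦ ‖m0 c x‖ ^ 2) n ξ = Real.pi := by
  have hcont : Continuous fun x ↦ ‖m0 c x‖ ^ 2 := (continuous_m0 c).norm.pow 2
  have hper : Function.Periodic (fun x ↦ ‖m0 c x‖ ^ 2) (2 * Real.pi) := fun x ↦ by
    have h1 := hc.ortho x
    have h2 := hc.ortho (Real.pi + x)
    rw [← add_assoc, ← two_mul, add_comm (2 * Real.pi) x] at h2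
    dsimp only
    linarith
  have h := integral_partialProd (q := fun x ↦ ‖m0 c x‖ ^ 2) (w := fun _ ↦ 1) (u := fun _ ↦ 1)
    hcont continuous_const continuous_const (fun x ↦ by rw [norm_m0_neg]) hper (fun _ ↦ rfl)
    (fun _ ↦ rfl) n
  simp only [mul_one, one_mul] at h
  rw [h]
  have hfix : transfer (fun x ↦ ‖m0 c x‖ ^ 2) (fun _ ↦ 1) = fun _ ↦ 1 := by
    funext x
    rw [transfer, mul_one, mul_one, sub_eq_add_neg]
    have := hc.ortho (-(x / 2))
    rwa [norm_m0_neg] at this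
  rw [Function.iterate_fixed hfix]
  simp

/-- Viète's telescoping by `sin 2t = 2 sin t cos t`, kept free of division so that zeros of the sine
need no care. -/
theorem four_pow_mul_sin_sq_mul_prod (x : ℝ) (n : ℕ) :
    4 ^ n * Real.sin (x / 2 ^ n / 2) ^ 2 *
      ∏ j ∈ Finset.range n, Real.cos (x / 2 ^ (j + 1) / 2) ^ 2 = Real.sin (x / 2) ^ 2 := by
  induction n with
  | zero => simp
  | succ n ih =>
    rw [← ih, Finset.prod_range_succ]
    have h : Real.sin (x / 2 ^ n / 2) =
        2 * Real.sin (x / 2 ^ (n + 1) / 2) * Real.cos (x / 2 ^ (n + 1) / 2) := by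
      rw [← Real.sin_two_mul]
      congr 1
      rw [pow_succ]
      field_simp
    rw [h]
    ring

theorem four_pow_mul_sin_sq_mul_norm_scalingProduct_sq {c : Fin 4 → ℝ} (hc : m0 c 0 = 1) {v : ℝ}
    (hv : HasParameter c v) (ξ : ℝ) (n : ℕ) :
    4 ^ n * Real.sin (ξ / 2 ^ n / 2) ^ 2 * ‖scalingProduct c ξ‖ ^ 2 =
      Real.sin (ξ / 2) ^ 2 * partialProd (r v) n ξ * ‖scalingProduct c (ξ / 2 ^ n)‖ ^ 2 := by
  rw [← four_pow_mul_sin_sq_mul_prod ξ n, scalingProduct_eq hc ξ n, norm_mul, mul_pow, norm_prod,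
    ← Finset.prod_pow]
  simp_rw [hv.norm_sq_m0_eq, ← cos_half_sq, Finset.prod_mul_distrib]
  rw [partialProd]
  ring

theorem lintegral_Ioc_ofReal {f : ℝ → ℝ} (hf : Continuous f) {b : ℝ} (hb : 0 ≤ b)
    (h0 : ∀ x ∈ Set.Ioc 0 b, 0 ≤ f x) :
    ∫⁻ x in Set.Ioc 0 b, ENNReal.ofReal (f x) = ENNReal.ofReal (∫ x in (0 : ℝ)..b, f x) := by
  rw [intervalIntegral.integral_of_le hb, ofReal_integral_eq_lintegral_ofReal
    (hf.integrableOn_Icc.mono_set Set.Ioc_subset_Icc_self)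
    ((ae_restrict_iff' measurableSet_Ioc).2 (Eventually.of_forall h0))]

/-! ### Dyadic energies and Sobolev energies -/

/-- The energy `∫_0^{2ⁿπ} ξ² |φ̂(ξ)|² dξ`. -/
def dyadicEnergy (c : Fin 4 → ℝ) (n : ℕ) : ENNReal :=
  ∫⁻ ξ in Set.Ioc 0 (2 ^ n * Real.pi), ENNReal.ofReal (ξ ^ 2 * ‖scalingProduct c ξ‖ ^ 2)

/-- The energy `∫ (1 + ξ²)^s |φ̂(ξ)|² dξ`. -/
def sobolevEnergy (c : Fin 4 → ℝ) (s : ℝ) : ENNReal :=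
  ∫⁻ ξ : ℝ, ENNReal.ofReal ((1 + ξ ^ 2) ^ s * ‖scalingProduct c ξ‖ ^ 2)

theorem div_two_pow_mem {n : ℕ} {ξ : ℝ} (hξ : ξ ∈ Set.Ioc 0 (2 ^ n * Real.pi)) :
    ξ / 2 ^ n ∈ Set.Icc 0 Real.pi := by
  refine ⟨div_nonneg hξ.1.le (by positivity), ?_⟩
  rw [div_le_iff₀ (by positivity), mul_comm]
  exact hξ.2

/-- Lower bounds of the energy by integrals of the transfer operator. -/
theorem le_dyadicEnergy {c : Fin 4 → ℝ} (hc : m0 c 0 = 1) {v : ℝ} (hv : HasParameter c v)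
    (hr : ∀ ξ, 0 ≤ r v ξ) {δ : ℝ} (hδ0 : 0 < δ)
    (hδ : ∀ ξ ∈ Set.Icc 0 Real.pi, δ ≤ ‖scalingProduct c ξ‖ ^ 2)
    {u : ℝ → ℝ} (hu : Continuous u) {C : ℝ} (hC : 0 < C) (hu0 : ∀ x, 0 ≤ u x)
    (huC : ∀ x, u x ≤ C) (n : ℕ) :
    ENNReal.ofReal (4 * δ / C * ∫ ξ in (0 : ℝ)..2 ^ n * Real.pi,
      Real.sin (ξ / 2) ^ 2 * partialProd (r v) n ξ * u (ξ / 2 ^ n)) ≤ dyadicEnergy c n := by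
  have hP := continuous_partialProd (r v).continuous n
  have hP0 := partialProd_nonneg hr n
  rw [← intervalIntegral.integral_const_mul, ← lintegral_Ioc_ofReal (by fun_prop) (by positivity)
    (fun ξ _ ↦ mul_nonneg (by positivity) (mul_nonneg (mul_nonneg (sq_nonneg _) (hP0 ξ)) (hu0 _)))]
  refine setLIntegral_mono' measurableSet_Ioc fun ξ hξ ↦ ENNReal.ofReal_le_ofReal ?_
  have hη := div_two_pow_mem hξ
  set η := ξ / 2 ^ n with hηd
  have hξη : ξ ^ 2 = 4 ^ n * η ^ 2 := by
    rw [hηd, div_pow, ← pow_mul, mul_comm n 2, pow_mul]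
    norm_num
    field_simp
  -- Here `sin t ≤ t` bounds the energy from below; the upper bound in `dyadicEnergy_le` uses
  -- Jordan's inequality `sin t ≥ 2t/π` instead.
  have hsin : 4 * Real.sin (η / 2) ^ 2 ≤ η ^ 2 := by
    have h0 := Real.sin_nonneg_of_nonneg_of_le_pi (x := η / 2) (by linarith [hη.1])
      (by linarith [hη.2, Real.pi_pos])
    have := pow_le_pow_left₀ h0 (Real.sin_le (by linarith [hη.1])) 2
    linarith
  have hS : 0 ≤ Real.sin (ξ / 2) ^ 2 * partialProd (r v) n ξ := mul_nonneg (sq_nonneg _) (hP0 ξ)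
  calc 4 * δ / C * (Real.sin (ξ / 2) ^ 2 * partialProd (r v) n ξ * u η)
      = 4 * (Real.sin (ξ / 2) ^ 2 * partialProd (r v) n ξ) * δ * (u η / C) := by
        field_simp
    _ ≤ 4 * (Real.sin (ξ / 2) ^ 2 * partialProd (r v) n ξ) * δ * 1 := by
        gcongr
        exact (div_le_one hC).2 (huC _)
    _ ≤ 4 * (Real.sin (ξ / 2) ^ 2 * partialProd (r v) n ξ) * ‖scalingProduct c η‖ ^ 2 := by
        rw [mul_one]
        gcongr
        exact hδ η hη
    _ = 4 ^ n * (4 * Real.sin (η / 2) ^ 2) * ‖scalingProduct c ξ‖ ^ 2 := by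
        rw [mul_assoc 4, ← four_pow_mul_sin_sq_mul_norm_scalingProduct_sq hc hv]
        ring
    _ ≤ 4 ^ n * η ^ 2 * ‖scalingProduct c ξ‖ ^ 2 := by gcongr
    _ = ξ ^ 2 * ‖scalingProduct c ξ‖ ^ 2 := by rw [hξη]

theorem dyadicEnergy_le {c : Fin 4 → ℝ} (hc : IsOrthonormalFilter c) {v : ℝ}
    (hv : HasParameter c v) (hr : ∀ ξ, 0 ≤ r v ξ) (n : ℕ) :
    dyadicEnergy c n ≤ ENNReal.ofReal (Real.pi ^ 2 * ∫ ξ in (0 : ℝ)..2 ^ n * Real.pi,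
      Real.sin (ξ / 2) ^ 2 * partialProd (r v) n ξ) := by
  have hP := continuous_partialProd (r v).continuous n
  have hP0 := partialProd_nonneg hr n
  rw [← intervalIntegral.integral_const_mul, ← lintegral_Ioc_ofReal (by fun_prop) (by positivity)
    (fun ξ _ ↦ mul_nonneg (by positivity) (mul_nonneg (sq_nonneg _) (hP0 ξ)))]
  refine setLIntegral_mono' measurableSet_Ioc fun ξ hξ ↦ ENNReal.ofReal_le_ofReal ?_
  have hη := div_two_pow_mem hξ
  set η := ξ / 2 ^ n with hηd
  have hξη : ξ ^ 2 = 4 ^ n * η ^ 2 := by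
    rw [hηd, div_pow, ← pow_mul, mul_comm n 2, pow_mul]
    norm_num
    field_simp
  have hsin : η ^ 2 ≤ Real.pi ^ 2 * Real.sin (η / 2) ^ 2 := by
    have h := Real.mul_le_sin (x := η / 2) (by linarith [hη.1]) (by linarith [hη.2])
    rw [← mul_pow]
    refine pow_le_pow_left₀ hη.1 ?_ 2
    calc η = Real.pi * (2 / Real.pi * (η / 2)) := by field_simp
      _ ≤ _ := by gcongr
  have hS : 0 ≤ Real.sin (ξ / 2) ^ 2 * partialProd (r v) n ξ := mul_nonneg (sq_nonneg _) (hP0 ξ)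
  calc ξ ^ 2 * ‖scalingProduct c ξ‖ ^ 2
      ≤ 4 ^ n * (Real.pi ^ 2 * Real.sin (η / 2) ^ 2) * ‖scalingProduct c ξ‖ ^ 2 := by
        rw [hξη]
        gcongr
    _ = Real.pi ^ 2 * ((Real.sin (ξ / 2) ^ 2 * partialProd (r v) n ξ) *
          ‖scalingProduct c η‖ ^ 2) := by
        rw [← four_pow_mul_sin_sq_mul_norm_scalingProduct_sq hc.map_zero hv]
        ring
    _ ≤ Real.pi ^ 2 * (Real.sin (ξ / 2) ^ 2 * partialProd (r v) n ξ) := by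
        exact mul_le_mul_of_nonneg_left (mul_le_of_le_one_right hS
          (pow_le_one₀ (norm_nonneg _) (norm_scalingProduct_le_one hc η))) (sq_nonneg _)

/-- The tail of the product has modulus at most `1`, so the partial product dominates. The bound
does not depend on `n`, hence `φ̂ ∈ L²`. -/
theorem lintegral_Ioc_norm_scalingProduct_sq_le {c : Fin 4 → ℝ} (hc : IsOrthonormalFilter c)
    (n : ℕ) :
    ∫⁻ ξ in Set.Ioc 0 (2 ^ n * Real.pi), ENNReal.ofReal (‖scalingProduct c ξ‖ ^ 2) ≤
      ENNReal.ofReal Real.pi := by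
  have hcont : Continuous fun x ↦ ‖m0 c x‖ ^ 2 := (continuous_m0 c).norm.pow 2
  have hP0 := partialProd_nonneg (q := fun x ↦ ‖m0 c x‖ ^ 2) (fun x ↦ sq_nonneg ‖m0 c x‖) n
  have heq := lintegral_Ioc_ofReal (b := 2 ^ n * Real.pi) (continuous_partialProd hcont n)
    (by positivity) fun ξ _ ↦ hP0 ξ
  rw [integral_partialProd_norm_sq_m0 hc n] at heq
  rw [← heq]
  refine setLIntegral_mono' measurableSet_Ioc fun ξ hξ ↦ ENNReal.ofReal_le_ofReal ?_
  rw [scalingProduct_eq hc.map_zero ξ n, norm_mul, mul_pow, norm_prod, ← Finset.prod_pow]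
  exact mul_le_of_le_one_right (hP0 ξ)
    (pow_le_one₀ (norm_nonneg _) (norm_scalingProduct_le_one hc _))

theorem lintegral_of_even {f : ℝ → ENNReal} (hf : ∀ x, f (-x) = f x) :
    ∫⁻ x, f x = 2 * ∫⁻ x in Set.Ioi 0, f x := by
  have h := (Measure.measurePreserving_neg (volume : Measure ℝ)).setLIntegral_comp_preimage_emb
    (MeasurableEquiv.neg ℝ).measurableEmbedding f (Set.Ioi 0)
  have hset : (Neg.neg ⁻¹' Set.Ioi 0 : Set ℝ) = Set.Iio 0 := by
    ext x
    simp
  rw [hset] at h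
  simp only [hf] at h
  rw [← lintegral_add_compl f measurableSet_Ioi, Set.compl_Ioi,
    ← setLIntegral_congr Iio_ae_eq_Iic, h, two_mul]

theorem iUnion_Ioc_two_pow_mul_pi : ⋃ n : ℕ, Set.Ioc 0 (2 ^ n * Real.pi) = Set.Ioi (0 : ℝ) := by
  ext x
  simp only [Set.mem_iUnion, Set.mem_Ioc, Set.mem_Ioi]
  refine ⟨fun ⟨_, h⟩ ↦ h.1, fun h ↦ ?_⟩
  obtain ⟨n, hn⟩ := pow_unbounded_of_one_lt (x / Real.pi) one_lt_two
  exact ⟨n, h, ((div_lt_iff₀ Real.pi_pos).1 hn).le⟩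

theorem lintegral_norm_scalingProduct_sq_lt_top {c : Fin 4 → ℝ} (hc : IsOrthonormalFilter c) :
    ∫⁻ ξ : ℝ, ENNReal.ofReal (‖scalingProduct c ξ‖ ^ 2) < ⊤ := by
  rw [lintegral_of_even fun x ↦ by rw [norm_scalingProduct_neg hc.map_zero],
    ← iUnion_Ioc_two_pow_mul_pi, setLIntegral_iUnion_of_directed]
  · exact ENNReal.mul_lt_top (by norm_num) ((iSup_le
      (lintegral_Ioc_norm_scalingProduct_sq_le hc)).trans_lt ENNReal.ofReal_lt_top)
  · refine Monotone.directed_le fun m n hmn ↦ Set.Ioc_subset_Ioc_right ?_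
    gcongr
    exact one_le_two

theorem sobolevEnergy_mono (c : Fin 4 → ℝ) {s t : ℝ} (h : s ≤ t) :
    sobolevEnergy c s ≤ sobolevEnergy c t := by
  refine lintegral_mono fun ξ ↦ ENNReal.ofReal_le_ofReal ?_
  gcongr
  linarith [sq_nonneg ξ]

theorem four_pow_rpow (n : ℕ) (t : ℝ) : ((4 : ℝ) ^ n) ^ t = ((4 : ℝ) ^ t) ^ n := by
  rw [← Real.rpow_natCast, ← Real.rpow_natCast, ← Real.rpow_mul (by norm_num),
    ← Real.rpow_mul (by norm_num), mul_comm]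

theorem one_add_sq_rpow (ξ s : ℝ) : (1 + ξ ^ 2) ^ s = (1 + ξ ^ 2) * (1 + ξ ^ 2) ^ (s - 1) := by
  have h : 0 < 1 + ξ ^ 2 := by positivity
  rw [Real.rpow_sub_one h.ne', mul_div_cancel₀ _ h.ne']

/-- If the dyadic energies grow fast, then the Sobolev energy is infinite. -/
theorem sobolevEnergy_eq_top {c : Fin 4 → ℝ} {s : ℝ} (hs : s ≤ 1) {a : ℕ → ℝ}
    (ha : ∀ n, ENNReal.ofReal (a n) ≤ dyadicEnergy c n)
    (htop : Tendsto (fun n ↦ ((4 : ℝ) ^ (s - 1)) ^ n * a n) atTop atTop) :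
    sobolevEnergy c s = ⊤ := by
  by_contra hne
  have hκ : 0 < (1 + Real.pi ^ 2) ^ (s - 1) := by positivity
  have hle (n : ℕ) : ENNReal.ofReal ((1 + Real.pi ^ 2) ^ (s - 1) * (((4 : ℝ) ^ (s - 1)) ^ n * a n))
      ≤ sobolevEnergy c s := by
    rw [← mul_assoc, ENNReal.ofReal_mul (by positivity)]
    calc _ ≤ ENNReal.ofReal ((1 + Real.pi ^ 2) ^ (s - 1) * ((4 : ℝ) ^ (s - 1)) ^ n) *
          dyadicEnergy c n := by gcongr; exact ha n
      _ = ∫⁻ ξ in Set.Ioc 0 (2 ^ n * Real.pi), ENNReal.ofReal ((1 + Real.pi ^ 2) ^ (s - 1) *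
          ((4 : ℝ) ^ (s - 1)) ^ n) * ENNReal.ofReal (ξ ^ 2 * ‖scalingProduct c ξ‖ ^ 2) :=
        (lintegral_const_mul' _ _ ENNReal.ofReal_ne_top).symm
      _ ≤ ∫⁻ ξ in Set.Ioc 0 (2 ^ n * Real.pi),
          ENNReal.ofReal ((1 + ξ ^ 2) ^ s * ‖scalingProduct c ξ‖ ^ 2) := by
        refine setLIntegral_mono' measurableSet_Ioc fun ξ hξ ↦ ?_
        rw [← ENNReal.ofReal_mul (by positivity)]
        refine ENNReal.ofReal_le_ofReal ?_
        -- As `s - 1 ≤ 0`, raising to that power reverses the inequality: passing from `ξ²` to the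
        -- weight `(1+ξ²)^s` on this interval costs at most a constant times `4^((s-1)n)`.
        have h1 : 1 + ξ ^ 2 ≤ 4 ^ n * (1 + Real.pi ^ 2) := by
          have h2 := pow_le_pow_left₀ hξ.1.le hξ.2 2
          have h3 : (1 : ℝ) ≤ 4 ^ n := one_le_pow₀ (by norm_num)
          have h4 : ((2 : ℝ) ^ n * Real.pi) ^ 2 = 4 ^ n * Real.pi ^ 2 := by
            rw [mul_pow, ← pow_mul, mul_comm n 2, pow_mul]; norm_num
          linarith
        have h2 := Real.rpow_le_rpow_of_nonpos (by positivity) h1 (sub_nonpos.2 hs)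
        rw [Real.mul_rpow (by positivity) (by positivity), four_pow_rpow] at h2
        rw [one_add_sq_rpow ξ s, ← mul_assoc]
        gcongr ?_ * _
        calc _ ≤ (1 + ξ ^ 2) ^ (s - 1) * (1 + ξ ^ 2) := by
              rw [mul_comm ((1 + Real.pi ^ 2) ^ (s - 1))]
              gcongr
              linarith
          _ = _ := mul_comm _ _
      _ ≤ _ := setLIntegral_le_lintegral _ _
  obtain ⟨n, hn⟩ := ((htop.const_mul_atTop hκ).eventually_gt_atTop
    (sobolevEnergy c s).toReal).exists
  exact absurd (hle n) (not_le.2 ((ENNReal.lt_ofReal_iff_toReal_lt hne).2 hn))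

/-- If the dyadic energies grow at most linearly, then the Sobolev energy is finite for `s < 1`. -/
theorem sobolevEnergy_lt_top {c : Fin 4 → ℝ} (hc : IsOrthonormalFilter c) {s : ℝ} (hs : s < 1)
    {A B : ℝ} (hA : 0 ≤ A) (hB : 0 ≤ B)
    (h : ∀ n, dyadicEnergy c n ≤ ENNReal.ofReal (A + B * n)) : sobolevEnergy c s < ⊤ := by
  have hmeas := measurable_scalingProduct hc.map_zero
  have hg : Measurable fun ξ : ℝ ↦ ENNReal.ofReal ((1 + ξ ^ 2) * ‖scalingProduct c ξ‖ ^ 2) := by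
    fun_prop
  have hρ0 : 0 ≤ (4 : ℝ) ^ (s - 1) := by positivity
  have hρ1 : (4 : ℝ) ^ (s - 1) < 1 := Real.rpow_lt_one_of_one_lt_of_neg (by norm_num) (by linarith)
  set ρ := (4 : ℝ) ^ (s - 1) with hρ
  have hsum : Summable fun n : ℕ ↦ ρ ^ n * (A + Real.pi + B * n) := by
    have h0 := summable_geometric_of_lt_one hρ0 hρ1
    have h1 := summable_pow_mul_geometric_of_norm_lt_one 1
      (by rwa [Real.norm_of_nonneg hρ0] : ‖ρ‖ < 1)
    refine ((h0.mul_left (A + Real.pi)).add (h1.mul_left B)).congr fun n ↦ ?_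
    rw [pow_one]
    ring
  have hint (n : ℕ) : ∫⁻ ξ in Set.Ioc 0 (2 ^ n * Real.pi),
      ENNReal.ofReal ((1 + ξ ^ 2) * ‖scalingProduct c ξ‖ ^ 2) ≤
        ENNReal.ofReal (A + Real.pi + B * n) := by
    calc _ = ∫⁻ ξ in Set.Ioc 0 (2 ^ n * Real.pi), (ENNReal.ofReal (ξ ^ 2 * ‖scalingProduct c ξ‖ ^ 2)
          + ENNReal.ofReal (‖scalingProduct c ξ‖ ^ 2)) := by
          refine lintegral_congr fun ξ ↦ ?_
          rw [← ENNReal.ofReal_add (by positivity) (by positivity)]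
          congr 1
          ring
      _ = dyadicEnergy c n + ∫⁻ ξ in Set.Ioc 0 (2 ^ n * Real.pi),
          ENNReal.ofReal (‖scalingProduct c ξ‖ ^ 2) := lintegral_add_right _ (by fun_prop)
      _ ≤ ENNReal.ofReal (A + B * n) + ENNReal.ofReal Real.pi :=
          add_le_add (h n) (lintegral_Ioc_norm_scalingProduct_sq_le hc n)
      _ = _ := by
          rw [← ENNReal.ofReal_add (by positivity) Real.pi_pos.le]
          congr 1
          ring
  have hpt (ξ : ℝ) (hξ : ξ ∈ Set.Ioi 0) :
      ENNReal.ofReal ((1 + ξ ^ 2) ^ s * ‖scalingProduct c ξ‖ ^ 2) ≤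
        ∑' n : ℕ, (Set.Ioc 0 (2 ^ n * Real.pi)).indicator (fun ξ ↦ ENNReal.ofReal (ρ ^ n) *
          ENNReal.ofReal ((1 + ξ ^ 2) * ‖scalingProduct c ξ‖ ^ 2)) ξ := by
    have hex : ∃ n : ℕ, ξ ∈ Set.Ioc 0 (2 ^ n * Real.pi) := by
      rw [← iUnion_Ioc_two_pow_mul_pi] at hξ
      exact Set.mem_iUnion.1 hξ
    classical
    -- The least dyadic interval containing `ξ` also bounds `ξ` from below, since `π ≥ 2`. One term
    -- of the sum then dominates, with weight `ρⁿ`, and linear growth is summable against it.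
    obtain ⟨n, hn, hmin⟩ : ∃ n : ℕ, ξ ∈ Set.Ioc 0 (2 ^ n * Real.pi) ∧ 4 ^ n ≤ 1 + ξ ^ 2 := by
      refine ⟨Nat.find hex, Nat.find_spec hex, ?_⟩
      rcases hN : Nat.find hex with _ | k
      · simpa using sq_nonneg ξ
      · have hk := Nat.find_min hex (m := k) (by omega)
        have hk' : 2 ^ k * Real.pi < ξ := by
          by_contra hcon
          exact hk ⟨hξ, not_lt.1 hcon⟩
        have h2 : (2 : ℝ) ^ (k + 1) ≤ ξ := by
          rw [pow_succ]
          refine le_trans ?_ hk'.le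
          gcongr
          exact Real.two_le_pi
        have h3 := pow_le_pow_left₀ (by positivity) h2 2
        rw [← pow_mul, mul_comm (k + 1) 2, pow_mul] at h3
        norm_num at h3
        linarith
    refine le_trans ?_ (ENNReal.le_tsum n)
    rw [Set.indicator_of_mem hn, ← ENNReal.ofReal_mul (by positivity)]
    refine ENNReal.ofReal_le_ofReal ?_
    rw [one_add_sq_rpow, hρ, ← four_pow_rpow, ← mul_assoc, mul_comm (1 + ξ ^ 2)]
    gcongr ?_ * _ * _
    exact Real.rpow_le_rpow_of_nonpos (by positivity) hmin (by linarith)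
  rw [sobolevEnergy, lintegral_of_even fun x ↦ by rw [norm_scalingProduct_neg hc.map_zero, neg_sq]]
  refine ENNReal.mul_lt_top (by norm_num) ?_
  calc _ ≤ ∫⁻ ξ in Set.Ioi 0, ∑' n : ℕ, (Set.Ioc 0 (2 ^ n * Real.pi)).indicator
          (fun ξ ↦ ENNReal.ofReal (ρ ^ n) *
          ENNReal.ofReal ((1 + ξ ^ 2) * ‖scalingProduct c ξ‖ ^ 2)) ξ :=
        setLIntegral_mono' measurableSet_Ioi hpt
    _ ≤ ∫⁻ ξ, ∑' n : ℕ, (Set.Ioc 0 (2 ^ n * Real.pi)).indicator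
          (fun ξ ↦ ENNReal.ofReal (ρ ^ n) *
          ENNReal.ofReal ((1 + ξ ^ 2) * ‖scalingProduct c ξ‖ ^ 2)) ξ :=
        setLIntegral_le_lintegral _ _
    _ = ∑' n : ℕ, ENNReal.ofReal (ρ ^ n) * ∫⁻ ξ in Set.Ioc 0 (2 ^ n * Real.pi),
          ENNReal.ofReal ((1 + ξ ^ 2) * ‖scalingProduct c ξ‖ ^ 2) := by
        rw [lintegral_tsum fun n ↦ ((hg.const_mul _).indicator measurableSet_Ioc).aemeasurable]
        refine tsum_congr fun n ↦ ?_
        rw [lintegral_indicator measurableSet_Ioc, lintegral_const_mul _ hg]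
    _ ≤ ∑' n : ℕ, ENNReal.ofReal (ρ ^ n * (A + Real.pi + B * n)) := by
        refine ENNReal.tsum_le_tsum fun n ↦ ?_
        rw [ENNReal.ofReal_mul (by positivity)]
        gcongr
        exact hint n
    _ = ENNReal.ofReal (∑' n : ℕ, ρ ^ n * (A + Real.pi + B * n)) :=
        (ENNReal.ofReal_tsum_of_nonneg (fun n ↦ mul_nonneg (by positivity)
          (by have := Real.pi_pos; positivity)) hsum).symm
    _ < ⊤ := ENNReal.ofReal_lt_top

/-! ### The Fourier transform on `L²` and the dilation equation -/

/-- The character `t ↦ e^{iat}`. -/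
def character (a : ℝ) (t : ℝ) : ℂ := Complex.exp ((a * t : ℝ) * Complex.I)

theorem norm_character (a t : ℝ) : ‖character a t‖ = 1 := Complex.norm_exp_ofReal_mul_I _

theorem continuous_character (a : ℝ) : Continuous (character a) := by
  unfold character
  fun_prop

theorem iteratedDeriv_character (a : ℝ) (n : ℕ) :
    iteratedDeriv n (character a) = fun t ↦ (a * Complex.I) ^ n * character a t := by
  induction n with
  | zero => simp
  | succ n ih =>
    rw [iteratedDeriv_succ, ih]
    funext t
    have h : HasDerivAt (fun t : ℝ ↦ ((a * t : ℝ) : ℂ) * Complex.I) (a * Complex.I) t := by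
      simpa using (((hasDerivAt_id t).const_mul a).ofReal_comp).mul_const Complex.I
    have h2 := (h.cexp.const_mul ((a * Complex.I) ^ n)).deriv
    simp only [character]
    rw [h2]
    ring

theorem hasTemperateGrowth_character (a : ℝ) : (character a).HasTemperateGrowth := by
  refine ⟨?_, fun n ↦ ⟨0, |a| ^ n, fun t ↦ ?_⟩⟩
  · unfold character
    have : ContDiff ℝ (⊤ : ℕ∞) fun t : ℝ ↦ ((a * t : ℝ) : ℂ) * Complex.I :=
      (Complex.ofRealCLM.contDiff.comp (contDiff_const.mul contDiff_id)).mul contDiff_const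
    exact this.cexp
  · rw [norm_iteratedFDeriv_eq_norm_iteratedDeriv, iteratedDeriv_character]
    simp [norm_character]

theorem map_affine_volume {a : ℝ} (ha : a ≠ 0) (b : ℝ) :
    Measure.map (fun x ↦ a * x + b) (volume : Measure ℝ) = ENNReal.ofReal |a⁻¹| • volume := by
  have : (fun x : ℝ ↦ a * x + b) = (· + b) ∘ (a * ·) := rfl
  rw [this, ← Measure.map_map (by fun_prop) (by fun_prop), Real.map_volume_mul_left ha,
    Measure.map_smul, map_add_right_eq_self]

theorem quasiMeasurePreserving_affine {a : ℝ} (ha : a ≠ 0) (b : ℝ) :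
    Measure.QuasiMeasurePreserving (fun x ↦ a * x + b) (volume : Measure ℝ) volume := by
  refine ⟨by fun_prop, ?_⟩
  rw [map_affine_volume ha]
  exact Measure.smul_absolutelyContinuous

theorem memLp_comp_affine {f : ℝ → ℂ} (hf : MemLp f 2 volume) {a : ℝ} (ha : a ≠ 0) (b : ℝ) :
    MemLp (fun x ↦ f (a * x + b)) 2 volume := by
  refine MemLp.comp_of_map (f := fun x ↦ a * x + b) ?_ (by fun_prop)
  rw [map_affine_volume ha]
  exact hf.smul_measure ENNReal.ofReal_ne_top

theorem integral_comp_affine (f : ℝ → ℂ) (a b : ℝ) :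
    ∫ x, f (a * x + b) = |a⁻¹| • ∫ y, f y := by
  rw [Measure.integral_comp_mul_left (fun x ↦ f (x + b)), integral_add_right_eq_self f b]

/-- The multiplication formula for the Fourier transform on `L²`. -/
theorem integral_schwartz_mul_fourier (f : L2) (h : 𝓢(ℝ, ℂ)) :
    ∫ ξ, h ξ * (𝓕 f : L2) ξ = ∫ x, (𝓕 h) x * f x := by
  have h1 := Lp.toTemperedDistribution_apply (𝓕 f : L2) h
  rw [← Lp.fourier_toTemperedDistribution_eq, TemperedDistribution.fourier_apply,
    Lp.toTemperedDistribution_apply] at h1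
  exact h1.symm

theorem ae_eq_of_forall_integral_schwartz_mul {f g : L2}
    (h : ∀ u : 𝓢(ℝ, ℂ), ∫ x, u x * f x = ∫ x, u x * g x) : f = g := by
  have hinj := LinearMap.ker_eq_bot.1
    (Lp.ker_toTemperedDistributionCLM_eq_bot (F := ℂ) (μ := (volume : Measure ℝ)) (p := 2))
  apply hinj
  ext u
  simpa [Lp.toTemperedDistribution_apply] using h u

/-- The Fourier transform of `x ↦ f(2x - k)`. -/
theorem fourier_comp_two_mul_sub {f g : L2} {k : ℝ} (hg : ∀ᵐ x, g x = f (2 * x - k)) :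
    ∀ᵐ ξ, (𝓕 g : L2) ξ = 1 / 2 * character (-(Real.pi * k)) ξ * (𝓕 f : L2) (ξ / 2) := by
  have hmem : MemLp (fun ξ ↦ 1 / 2 * character (-(Real.pi * k)) ξ * (𝓕 f : L2) (ξ / 2))
      2 volume := by
    have h1 := memLp_comp_affine (Lp.memLp (𝓕 f : L2)) (a := 1 / 2) (by norm_num) 0
    have h2 : (fun ξ : ℝ ↦ (𝓕 f : L2) (1 / 2 * ξ + 0)) = fun ξ ↦ (𝓕 f : L2) (ξ / 2) := by
      funext ξ
      congr 1
      ring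
    rw [h2] at h1
    refine h1.of_le_mul (c := 1 / 2) ?_ (Eventually.of_forall fun ξ ↦ ?_)
    · exact ((continuous_const.mul (continuous_character _)).aestronglyMeasurable).mul h1.1
    · simp [norm_character]
  suffices h : (𝓕 g : L2) = hmem.toLp _ by
    rw [h]
    exact hmem.coeFn_toLp
  refine ae_eq_of_forall_integral_schwartz_mul fun u ↦ ?_
  let e : ℝ ≃L[ℝ] ℝ := ContinuousLinearEquiv.unitsEquivAut ℝ (Units.mk0 2 two_ne_zero)
  have he (t : ℝ) : e t = 2 * t := by simp [e, mul_comm]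
  -- The `L²` transform is known only by duality, so the dilation and shift are moved to the test
  -- function: both sides become `∫ w · 𝓕 f`.
  let w : 𝓢(ℝ, ℂ) := SchwartzMap.smulLeftCLM ℂ (character (-(2 * Real.pi * k)))
    (SchwartzMap.compCLMOfContinuousLinearEquiv ℂ e u)
  have hw (t : ℝ) : w t = character (-(2 * Real.pi * k)) t * u (2 * t) := by
    simp only [w]
    rw [SchwartzMap.smulLeftCLM_apply_apply (hasTemperateGrowth_character _),
      SchwartzMap.compCLMOfContinuousLinearEquiv_apply, Function.comp_apply, he, smul_eq_mul]
  have hFw (y : ℝ) : (𝓕 u) ((y + k) / 2) = 2 * (𝓕 w) y := by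
    rw [SchwartzMap.fourier_coe, SchwartzMap.fourier_coe, Real.fourier_eq', Real.fourier_eq']
    have h1 := integral_comp_affine (fun t ↦ Complex.exp ((-2 * Real.pi * ((y + k) / 2 * t) : ℝ) *
      Complex.I) * u t) 2 0
    have h2 : ∫ t, Complex.exp ((-2 * Real.pi * (y * t) : ℝ) * Complex.I) * w t =
        ∫ t, Complex.exp ((-2 * Real.pi * ((y + k) / 2 * (2 * t + 0)) : ℝ) * Complex.I) *
          u (2 * t + 0) := by
      refine integral_congr_ae (Eventually.of_forall fun t ↦ ?_)
      dsimp only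
      rw [hw, ← mul_assoc, character, ← Complex.exp_add, add_zero]
      congr 2
      push_cast
      ring
    simp only [RCLike.inner_apply, conj_trivial, smul_eq_mul]
    rw [h2, h1, Complex.real_smul, ← mul_assoc]
    norm_num
  rw [integral_schwartz_mul_fourier]
  have hleft : ∫ x, (𝓕 u) x * g x = ∫ t, w t * (𝓕 f : L2) t := by
    rw [integral_schwartz_mul_fourier]
    have h1 := integral_comp_affine (fun y ↦ (𝓕 u) ((y + k) / 2) * f y) 2 (-k)
    have h2 : ∫ x, (𝓕 u) x * g x = ∫ x, (𝓕 u) ((2 * x + -k + k) / 2) * f (2 * x + -k) := by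
      refine integral_congr_ae (hg.mono fun x hx ↦ ?_)
      dsimp only
      rw [hx, ← sub_eq_add_neg, sub_add_cancel, mul_div_cancel_left₀ _ two_ne_zero]
    rw [h2, h1]
    simp only [hFw, mul_assoc]
    rw [integral_const_mul, Complex.real_smul, ← mul_assoc]
    norm_num
  have hright : ∫ ξ, u ξ * (hmem.toLp _ : L2) ξ = ∫ t, w t * (𝓕 f : L2) t := by
    have h1 := integral_comp_affine
      (fun ξ ↦ character (-(Real.pi * k)) ξ * u ξ * (𝓕 f : L2) (ξ / 2)) 2 0
    have h2 : ∫ t, w t * (𝓕 f : L2) t = ∫ t, character (-(Real.pi * k)) (2 * t + 0) *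
        u (2 * t + 0) * (𝓕 f : L2) ((2 * t + 0) / 2) := by
      refine integral_congr_ae (Eventually.of_forall fun t ↦ ?_)
      dsimp only
      rw [hw, add_zero, mul_div_cancel_left₀ _ two_ne_zero, character, character]
      congr 4
      push_cast
      ring
    rw [h2, h1, Complex.real_smul, ← integral_const_mul]
    refine integral_congr_ae (hmem.coeFn_toLp.mono fun ξ hξ ↦ ?_)
    dsimp only
    rw [hξ]
    norm_num
    ring
  rw [hleft, hright]

theorem memLp_scalingProduct {c : Fin 4 → ℝ} (hc : IsOrthonormalFilter c) :
    MemLp (scalingProduct c) 2 volume := by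
  have hm := measurable_scalingProduct hc.map_zero
  rw [memLp_two_iff_integrable_sq_norm hm.aestronglyMeasurable]
  refine ⟨(hm.norm.pow_const 2).aestronglyMeasurable, ?_⟩
  rw [hasFiniteIntegral_iff_ofReal (Eventually.of_forall fun _ ↦ sq_nonneg _)]
  exact lintegral_norm_scalingProduct_sq_lt_top hc

theorem memLp_scalingProduct_comp {c : Fin 4 → ℝ} (hc : IsOrthonormalFilter c) :
    MemLp (fun t ↦ scalingProduct c (2 * Real.pi * t)) 2 volume := by
  simpa using memLp_comp_affine (memLp_scalingProduct hc) (a := 2 * Real.pi)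
    (by simp [Real.pi_ne_zero]) 0

/-- The normalization of `hat` is that of Mathlib's Fourier transform up to dilation. -/
theorem hat_ae_eq_iff (φ : L2) (F : ℝ → ℂ) :
    (∀ᵐ ξ : ℝ, hat φ ξ = F ξ) ↔ ∀ᵐ t : ℝ, (𝓕 φ : L2) t = F (2 * Real.pi * t) := by
  have hpi : 2 * Real.pi ≠ 0 := by simp [Real.pi_ne_zero]
  constructor
  · intro h
    refine ((quasiMeasurePreserving_affine hpi 0).ae h).mono fun t ht ↦ ?_
    rwa [hat, add_zero, mul_div_cancel_left₀ _ hpi] at ht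
  · intro h
    refine ((quasiMeasurePreserving_affine (inv_ne_zero hpi) 0).ae h).mono fun ξ hξ ↦ ?_
    rwa [add_zero, mul_inv_cancel_left₀ hpi, inv_mul_eq_div] at hξ

theorem coeFn_sqrt_two_smul_sum (c : Fin 4 → ℝ) (f : Fin 4 → L2) :
    ∀ᵐ x, (((√2 : ℝ) : ℂ) • ∑ k, (c k : ℂ) • f k : L2) x =
      ((√2 : ℝ) : ℂ) * ∑ k, (c k : ℂ) * f k x := by
  have h (k : Fin 4) := Lp.coeFn_smul (c k : ℂ) (f k)
  simp only [Fin.sum_univ_four]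
  filter_upwards [Lp.coeFn_smul ((√2 : ℝ) : ℂ)
      ((c 0 : ℂ) • f 0 + (c 1 : ℂ) • f 1 + (c 2 : ℂ) • f 2 + (c 3 : ℂ) • f 3), h 0, h 1, h 2, h 3,
    Lp.coeFn_add ((c 0 : ℂ) • f 0 + (c 1 : ℂ) • f 1 + (c 2 : ℂ) • f 2) ((c 3 : ℂ) • f 3),
    Lp.coeFn_add ((c 0 : ℂ) • f 0 + (c 1 : ℂ) • f 1) ((c 2 : ℂ) • f 2),
    Lp.coeFn_add ((c 0 : ℂ) • f 0) ((c 1 : ℂ) • f 1)] with x h1 h2 h3 h4 h5 h6 h7 h8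
  simp only [h1, h6, h7, h8, Pi.smul_apply, Pi.add_apply, h2, h3, h4, h5, smul_eq_mul]

/-- Splitting off the first factor gives `φ̂(ξ) = m₀(ξ/2) φ̂(ξ/2)`, which is the transform of the
dilation equation; injectivity of the transform does the rest. -/
theorem dilation_of_fourier {c : Fin 4 → ℝ} (hc : m0 c 0 = 1) {φ : L2}
    (hφ : ∀ᵐ ξ : ℝ, hat φ ξ = scalingProduct c ξ) :
    ∀ᵐ x : ℝ, φ x = ((√2 : ℝ) : ℂ) * ∑ k : Fin 4, (c k : ℂ) * φ (2 * x - (k : ℕ)) := by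
  have hF := (hat_ae_eq_iff φ _).1 hφ
  have hmem (k : Fin 4) := memLp_comp_affine (Lp.memLp φ) two_ne_zero (-((k : ℕ) : ℝ))
  let ψ (k : Fin 4) : L2 := (hmem k).toLp _
  have hψ (k : Fin 4) : ∀ᵐ x, ψ k x = φ (2 * x - (k : ℕ)) := (hmem k).coeFn_toLp
  let Ψ : L2 := ((√2 : ℝ) : ℂ) • ∑ k, (c k : ℂ) • ψ k
  have hFΨ : (𝓕 Ψ : L2) = ((√2 : ℝ) : ℂ) • ∑ k, (c k : ℂ) • (𝓕 (ψ k) : L2) := by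
    change Lp.fourierTransformₗᵢ ℝ ℂ Ψ = ((√2 : ℝ) : ℂ) • ∑ k, (c k : ℂ) •
      Lp.fourierTransformₗᵢ ℝ ℂ (ψ k)
    simp only [Ψ, map_smul, map_sum]
  have hhalf : ∀ᵐ ξ, (𝓕 φ : L2) (ξ / 2) = scalingProduct c (Real.pi * ξ) := by
    refine ((quasiMeasurePreserving_affine (a := 1 / 2) (by norm_num) 0).ae hF).mono fun ξ hξ ↦ ?_
    rw [show 1 / 2 * ξ + 0 = ξ / 2 by ring, show 2 * Real.pi * (ξ / 2) = Real.pi * ξ by ring] at hξ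
    exact hξ
  have hfix : Ψ = φ := by
    apply (Lp.fourierTransformₗᵢ ℝ ℂ).injective
    change (𝓕 Ψ : L2) = (𝓕 φ : L2)
    refine Lp.ext ?_
    rw [hFΨ]
    filter_upwards [coeFn_sqrt_two_smul_sum c fun k ↦ (𝓕 (ψ k) : L2), hF, hhalf,
      ae_all_iff.2 fun k ↦ fourier_comp_two_mul_sub (hψ k)] with ξ h1 h2 h3 h4
    rw [h1, h2]
    simp only [h4, h3]
    have h5 := scalingProduct_eq hc (2 * Real.pi * ξ) 1
    simp only [Finset.prod_range_one, zero_add, pow_one] at h5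
    rw [h5, show 2 * Real.pi * ξ / 2 = Real.pi * ξ by ring, m0, Finset.mul_sum, Finset.mul_sum,
      Finset.sum_mul]
    refine Finset.sum_congr rfl fun k _ ↦ ?_
    have h6 : character (-(Real.pi * ((k : ℕ) : ℝ))) ξ =
        Complex.exp (-Complex.I * ((k : ℕ) : ℂ) * ((Real.pi * ξ : ℝ) : ℂ)) := by
      rw [character]
      congr 1
      push_cast
      ring
    have h7 : (1 : ℂ) / ((√2 : ℝ) : ℂ) = ((√2 : ℝ) : ℂ) * (1 / 2) := by
      have h8 : (1 : ℝ) / √2 = √2 * (1 / 2) := by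
        rw [div_eq_iff (by positivity)]
        linarith [Real.mul_self_sqrt (show (0 : ℝ) ≤ 2 by norm_num)]
      simpa using congrArg ((↑) : ℝ → ℂ) h8
    rw [h6, h7]
    ring
  filter_upwards [coeFn_sqrt_two_smul_sum c ψ, ae_all_iff.2 hψ] with x h1 h2
  rw [← hfix]
  rw [h1]
  simp only [h2, hfix]

/-- The product formula alone fixes `φ`, by Plancherel; the dilation equation is a consequence and
plays no part in uniqueness. -/
theorem existsUnique_isScalingFunction {c : Fin 4 → ℝ} (hc : IsOrthonormalFilter c) :
    ∃! φ : L2, IsScalingFunction c φ := by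
  set G : L2 := (memLp_scalingProduct_comp hc).toLp _ with hG
  have hGe : ∀ᵐ t, G t = scalingProduct c (2 * Real.pi * t) :=
    (memLp_scalingProduct_comp hc).coeFn_toLp
  refine ⟨(Lp.fourierTransformₗᵢ ℝ ℂ).symm G, ?_, fun φ hφ ↦ ?_⟩
  · have h : ∀ᵐ ξ, hat ((Lp.fourierTransformₗᵢ ℝ ℂ).symm G) ξ = scalingProduct c ξ := by
      rw [hat_ae_eq_iff]
      change ∀ᵐ t, (Lp.fourierTransformₗᵢ ℝ ℂ ((Lp.fourierTransformₗᵢ ℝ ℂ).symm G)) t = _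
      rwa [LinearIsometryEquiv.apply_symm_apply]
    exact ⟨dilation_of_fourier hc.map_zero h, h⟩
  · rw [LinearIsometryEquiv.eq_symm_apply]
    refine Lp.ext ?_
    filter_upwards [hGe, (hat_ae_eq_iff φ (scalingProduct c)).1 hφ.fourier] with t h1 h2
    rw [h1]
    exact h2

theorem IsScalingFunction.memH_iff {c : Fin 4 → ℝ} (hc : IsOrthonormalFilter c) {φ : L2}
    (hφ : IsScalingFunction c φ) (s : ℝ) : MemH s φ ↔ sobolevEnergy c s < ⊤ := by
  have hm := measurable_scalingProduct hc.map_zero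
  have hae : (fun ξ : ℝ ↦ (((1 + |ξ| ^ 2) ^ (s / 2) : ℝ) : ℂ) * hat φ ξ) =ᵐ[volume]
      fun ξ : ℝ ↦ (((1 + ξ ^ 2) ^ (s / 2) : ℝ) : ℂ) * scalingProduct c ξ := by
    filter_upwards [hφ.fourier] with ξ hξ
    rw [hξ, sq_abs]
    rfl
  have hmeas : Measurable fun ξ : ℝ ↦ (((1 + ξ ^ 2) ^ (s / 2) : ℝ) : ℂ) * scalingProduct c ξ := by
    fun_prop
  have hsq (ξ : ℝ) : ‖(((1 + ξ ^ 2) ^ (s / 2) : ℝ) : ℂ) * scalingProduct c ξ‖ ^ 2 =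
      (1 + ξ ^ 2) ^ s * ‖scalingProduct c ξ‖ ^ 2 := by
    have h0 : 0 ≤ 1 + ξ ^ 2 := by positivity
    rw [norm_mul, mul_pow, Complex.norm_real, Real.norm_of_nonneg (by positivity),
      ← Real.rpow_natCast, ← Real.rpow_mul h0]
    norm_num
  rw [MemH, memLp_congr_ae hae, memLp_two_iff_integrable_sq_norm hmeas.aestronglyMeasurable]
  simp_rw [hsq]
  rw [Integrable, hasFiniteIntegral_iff_ofReal (Eventually.of_forall fun ξ ↦ by positivity),
    sobolevEnergy, and_iff_right]
  exact Measurable.aestronglyMeasurable (by fun_prop)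

/-! ### Growth of the energies and the Sobolev exponent -/

theorem r_pos {v : ℝ} (h1 : -8 < v) (h2 : v ≤ 1) {ξ : ℝ} (hξ : 0 ≤ Real.cos ξ) : 0 < r v ξ := by
  rw [r_apply]
  have b := Real.cos_le_one ξ
  nlinarith [sq_nonneg (Real.cos ξ - 1 / 2), mul_nonneg hξ (sub_nonneg.2 b)]

theorem exists_le_norm_scalingProduct_of_hasParameter {c : Fin 4 → ℝ} (hc : m0 c 0 = 1) {v : ℝ}
    (hv : HasParameter c v) (h1 : -8 < v) (h2 : v ≤ 1) :
    ∃ δ : ℝ, 0 < δ ∧ ∀ ξ ∈ Set.Icc 0 Real.pi, δ ≤ ‖scalingProduct c ξ‖ ^ 2 := by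
  refine exists_le_norm_scalingProduct hc fun ξ hξ h0 ↦ ?_
  have hcos : 0 ≤ Real.cos ξ :=
    Real.cos_nonneg_of_neg_pi_div_two_le_of_le (by linarith [hξ.1, Real.pi_pos]) hξ.2
  have h := hv.norm_sq_m0_eq ξ
  have hr := r_pos h1 h2 hcos
  rw [h0, norm_zero] at h
  have : 0 < (1 + Real.cos ξ) / 2 * r v ξ := by positivity
  norm_num at h
  rcases h with h | h <;> linarith

/-- At `v = -8` one has `|m₀(x)|² = cos²(3x/2)`, so telescoping at `3ξ` compares `φ̂` with a sinc
function; the tail tends to `1`. -/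
theorem sin_sq_le_of_parameter_neg_eight {c : Fin 4 → ℝ} (hc : m0 c 0 = 1)
    (hv : HasParameter c (-8)) (ξ : ℝ) :
    Real.sin (3 * ξ / 2) ^ 2 ≤ 9 / 4 * (ξ ^ 2 * ‖scalingProduct c ξ‖ ^ 2) := by
  have hm (x : ℝ) : ‖m0 c x‖ ^ 2 = Real.cos (3 * x / 2) ^ 2 := by
    rw [hv x, cos_half_sq]
    ring
  have hlim : Tendsto (fun n : ℕ ↦ Real.sin (3 * ξ / 2) ^ 2 * ‖scalingProduct c (ξ / 2 ^ n)‖ ^ 2)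
      atTop (𝓝 (Real.sin (3 * ξ / 2) ^ 2)) := by
    have h1 : Tendsto (fun n : ℕ ↦ ξ / 2 ^ n) atTop (𝓝 0) :=
      tendsto_const_nhds.div_atTop (tendsto_pow_atTop_atTop_of_one_lt one_lt_two)
    have := (((tendsto_scalingProduct_zero hc).comp h1).norm.pow 2).const_mul
      (Real.sin (3 * ξ / 2) ^ 2)
    simpa using this
  refine le_of_tendsto hlim (Eventually.of_forall fun n ↦ ?_)
  rw [← four_pow_mul_sin_sq_mul_prod (3 * ξ) n]
  have hprod : ∏ j ∈ Finset.range n, Real.cos (3 * ξ / 2 ^ (j + 1) / 2) ^ 2 =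
      ‖∏ j ∈ Finset.range n, m0 c (ξ / 2 ^ (j + 1))‖ ^ 2 := by
    rw [norm_prod, ← Finset.prod_pow]
    refine Finset.prod_congr rfl fun j _ ↦ ?_
    rw [hm]
    congr 2
    ring
  rw [hprod, mul_assoc, ← mul_pow, ← norm_mul, ← scalingProduct_eq hc, ← mul_assoc]
  gcongr ?_ * _
  have h1 := Real.sin_sq_le_sq (x := 3 * ξ / 2 ^ n / 2)
  calc (4 : ℝ) ^ n * Real.sin (3 * ξ / 2 ^ n / 2) ^ 2 ≤ 4 ^ n * (3 * ξ / 2 ^ n / 2) ^ 2 := by gcongr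
    _ = 9 / 4 * ξ ^ 2 := by
      rw [div_pow, div_pow, ← pow_mul, mul_comm n 2, pow_mul]
      norm_num
      field_simp
      norm_num
      ring

theorem exists_growth {c : Fin 4 → ℝ} (hc : m0 c 0 = 1) {v : ℝ} (hv : HasParameter c v)
    (h2 : v < 1) :
    ∃ l a : ℝ, 1 < l ∧ 0 < a ∧ ∀ n, ENNReal.ofReal (a * l ^ n) ≤ dyadicEnergy c n := by
  rcases hv.neg_eight_le.eq_or_lt with rfl | h1
  -- The zero of `m₀` at `π/3` rules out the general lower bound. The rate `2` is the length of the
  -- interval, over which `sin²(3ξ/2)` has mean `1/2`.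
  · refine ⟨2, 4 / 9 * (Real.pi / 2), one_lt_two, by positivity, fun n ↦ ?_⟩
    have hint : ∫ ξ in (0 : ℝ)..2 ^ n * Real.pi, 4 / 9 * Real.sin (3 * ξ / 2) ^ 2 =
        4 / 9 * (Real.pi / 2) * 2 ^ n := by
      have h3 (ξ : ℝ) : 4 / 9 * Real.sin (3 * ξ / 2) ^ 2 = 2 / 9 - 2 / 9 * Real.cos (3 * ξ) := by
        rw [sin_half_sq]; ring
      simp_rw [h3]
      rw [intervalIntegral.integral_sub (by simp) (Continuous.intervalIntegrable (by fun_prop) _ _),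
        intervalIntegral.integral_const_mul, intervalIntegral.integral_comp_mul_left _ three_ne_zero,
        integral_cos, show 3 * (2 ^ n * Real.pi) = ((3 * 2 ^ n : ℕ) : ℝ) * Real.pi by
          push_cast; ring, Real.sin_nat_mul_pi]
      simp
      ring
    rw [← hint, ← lintegral_Ioc_ofReal (by fun_prop) (by positivity) fun _ _ ↦ by positivity]
    refine lintegral_mono fun ξ ↦ ENNReal.ofReal_le_ofReal ?_
    linarith [sin_sq_le_of_parameter_neg_eight hc hv ξ]
  · obtain ⟨δ, hδ0, hδ⟩ := exists_le_norm_scalingProduct_of_hasParameter hc hv h1 h2.le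
    have hs : 0 < √(1 - v) := Real.sqrt_pos.2 (by linarith)
    have hl : 1 < 1 + √(1 - v) := by linarith
    refine ⟨1 + √(1 - v), 4 * δ / (4 * (1 + √(1 - v)) - 2 * v + 2 * |v|) *
      (Real.pi / 2 * (4 * (1 + √(1 - v)) - v)), hl, ?_, fun n ↦ ?_⟩
    · have : 0 < 4 * (1 + √(1 - v)) - v := by linarith
      have : 0 < 4 * (1 + √(1 - v)) - 2 * v + 2 * |v| := by linarith [le_abs_self v]
      positivity
    · have hb (x : ℝ) : |2 * v * Real.cos x| ≤ 2 * |v| := by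
        rw [abs_mul, abs_mul, abs_two]
        exact mul_le_of_le_one_right (by positivity) (Real.abs_cos_le_one x)
      have h := le_dyadicEnergy hc hv ((r_nonneg_iff v).2 ⟨h1.le, h2.le⟩) hδ0 hδ
        (u := fun y ↦ (4 * (1 + √(1 - v)) - 2 * v) + (-(2 * v)) * Real.cos y) (by fun_prop)
        (C := 4 * (1 + √(1 - v)) - 2 * v + 2 * |v|) (by linarith [le_abs_self v])
        (fun x ↦ by
          have := (abs_le.1 (hb x)).2
          rcases abs_cases v with h | h <;> linarith)
        (fun x ↦ by linarith [(abs_le.1 (hb x)).1]) n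
      rw [integral_partialProd_eigenfunction h2.le] at h
      convert h using 2
      ring

theorem exists_sobolevEnergy_eq_top {c : Fin 4 → ℝ} (hc : m0 c 0 = 1) {v : ℝ}
    (hv : HasParameter c v) (h2 : v < 1) : ∃ s < 1, sobolevEnergy c s = ⊤ := by
  obtain ⟨l, a, hl, ha, h⟩ := exists_growth hc hv h2
  have hlog : 0 < Real.log l := Real.log_pos hl
  have hlog4 : 0 < Real.log 4 := Real.log_pos (by norm_num)
  -- Chosen so that `4^(s-1) = l^(-1/2)`: the growth `lⁿ` still wins, with `l^(n/2)` left over.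
  refine ⟨1 - Real.log l / (2 * Real.log 4), by linarith [div_pos hlog (mul_pos two_pos hlog4)],
    sobolevEnergy_eq_top (by linarith [div_pos hlog (mul_pos two_pos hlog4)]) h ?_⟩
  have hq : (4 : ℝ) ^ (1 - Real.log l / (2 * Real.log 4) - 1) * l = Real.exp (Real.log l / 2) := by
    nth_rw 2 [← Real.exp_log (by linarith : 0 < l)]
    rw [Real.rpow_def_of_pos (by norm_num), ← Real.exp_add]
    congr 1
    field_simp
    ring
  have h1 : 1 < Real.exp (Real.log l / 2) := Real.one_lt_exp_iff.2 (by linarith)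
  refine ((tendsto_pow_atTop_atTop_of_one_lt h1).const_mul_atTop ha).congr fun n ↦ ?_
  rw [← hq, mul_pow]
  ring

theorem sobolevEnergy_one_eq_top {c : Fin 4 → ℝ} (hc : m0 c 0 = 1)
    (hv : HasParameter c 1) : sobolevEnergy c 1 = ⊤ := by
  obtain ⟨δ, hδ0, hδ⟩ := exists_le_norm_scalingProduct_of_hasParameter hc hv (by norm_num) le_rfl
  have h := le_dyadicEnergy hc hv ((r_nonneg_iff 1).2 ⟨by norm_num, le_rfl⟩) hδ0 hδ
    (u := fun _ ↦ 1) continuous_const one_pos (fun _ ↦ zero_le_one) (fun _ ↦ le_rfl)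
  simp only [mul_one, integral_partialProd_r_one] at h
  refine sobolevEnergy_eq_top le_rfl h ?_
  simp only [sub_self, Real.rpow_zero, one_pow, one_mul]
  refine Tendsto.const_mul_atTop (by positivity) (tendsto_atTop_add_const_left _ _ ?_)
  exact tendsto_natCast_atTop_atTop.const_mul_atTop (by positivity)

theorem sobolevEnergy_lt_top_of_parameter_one {c : Fin 4 → ℝ} (hc : IsOrthonormalFilter c)
    (hv : HasParameter c 1) {s : ℝ} (hs : s < 1) : sobolevEnergy c s < ⊤ := by
  refine sobolevEnergy_lt_top hc hs (A := Real.pi ^ 2 * (Real.pi / 2))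
    (B := Real.pi ^ 2 * (3 * Real.pi / 8)) (by positivity) (by positivity) fun n ↦ ?_
  have h := dyadicEnergy_le hc hv ((r_nonneg_iff 1).2 ⟨by norm_num, le_rfl⟩) n
  rw [integral_partialProd_r_one, mul_add, ← mul_assoc _ _ (n : ℝ)] at h
  exact h

/-- The energy is monotone in `s`, so any exponent with infinite energy is an upper bound. For `v <
1` there is one strictly below `1`; for `v = 1` the bound `1` is approached by finite energies. -/
theorem IsScalingFunction.exists_isSobolevExponent {c : Fin 4 → ℝ} (hc : IsOrthonormalFilter c)
    {v : ℝ} (hv : HasParameter c v) (hv1 : v ≤ 1) {φ : L2} (hφ : IsScalingFunction c φ) :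
    ∃ s₀ : ℝ, IsSobolevExponent φ s₀ ∧ s₀ ≤ 1 ∧ (v = 1 → s₀ = 1) ∧ (v < 1 → s₀ < 1) := by
  have hub {t : ℝ} (ht : sobolevEnergy c t = ⊤) : t ∈ upperBounds {s : ℝ | MemH s φ} := by
    intro s hs
    by_contra hcon
    have h1 := (hφ.memH_iff hc s).1 hs
    have h2 := sobolevEnergy_mono c (not_le.1 hcon).le
    rw [ht] at h2
    exact absurd h1 (not_lt.2 h2)
  have hne : {s : ℝ | MemH s φ}.Nonempty := by
    refine ⟨0, (hφ.memH_iff hc 0).2 ?_⟩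
    simpa [sobolevEnergy] using lintegral_norm_scalingProduct_sq_lt_top hc
  rcases hv1.lt_or_eq with hlt | rfl
  · obtain ⟨t, ht1, ht⟩ := exists_sobolevEnergy_eq_top hc.map_zero hv hlt
    obtain ⟨s₀, hs₀⟩ := Real.exists_isLUB hne ⟨t, hub ht⟩
    have hle := hs₀.2 (hub ht)
    exact ⟨s₀, hs₀, by linarith, fun h ↦ absurd h hlt.ne, fun _ ↦ by linarith⟩
  · refine ⟨1, ⟨hub (sobolevEnergy_one_eq_top hc.map_zero hv), fun b hb ↦ ?_⟩, le_rfl,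
      fun _ ↦ rfl, fun h ↦ absurd h (lt_irrefl _)⟩
    refine le_of_forall_lt fun s hs ↦ ?_
    obtain ⟨s', h1, h2⟩ := exists_between hs
    exact h1.trans_le (hb ((hφ.memH_iff hc s').2
      (sobolevEnergy_lt_top_of_parameter_one hc hv h2)))

end Wavelet

end

theorem mainTheorem1 :
    -- the operator `T_r` on the span of `1, cos ξ, cos 2ξ`
    LinearIndependent ℂ Wavelet.cosFun ∧
    (∀ v : ℝ,
      (0 ≤ Wavelet.r v Real.pi ↔ v ≤ 1) ∧
      (∀ i : Fin 3, Wavelet.T (Wavelet.r v) (Wavelet.cosFun i) =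
        ∑ j : Fin 3, (Wavelet.transferMatrix v i j : ℂ) • Wavelet.cosFun j) ∧
      (∀ u ∈ Wavelet.cosSpan, Wavelet.T (Wavelet.r v) u ∈ Wavelet.cosSpan) ∧
      (v ≤ 1 →
        (Wavelet.transferMatrix v).charpoly =
          (Polynomial.X - Polynomial.C (1 + √(1 - v))) *
          (Polynomial.X - Polynomial.C (1 - √(1 - v))) *
          (Polynomial.X - Polynomial.C (-v / 4)) ∧
        (∀ μ : ℂ, Wavelet.IsEigenvalueOnSpan (Wavelet.r v) μ ↔
          μ = ((1 + √(1 - v) : ℝ) : ℂ) ∨ μ = ((1 - √(1 - v) : ℝ) : ℂ) ∨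
            μ = ((-v / 4 : ℝ) : ℂ)) ∧
        1 ≤ spectralRadius ℂ (Wavelet.T (Wavelet.r v)))) ∧
    -- the values of the parameter that occur
    (∀ v : ℝ,
      (∃ c : Fin 4 → ℝ, Wavelet.IsOrthonormalFilter c ∧ 1 ≤ Wavelet.vanishingMoments c ∧
        Wavelet.HasParameter c v) ↔ ∀ ξ : ℝ, 0 ≤ Wavelet.r v ξ) ∧
    -- the Sobolev exponents of the family
    (∀ c : Fin 4 → ℝ, Wavelet.IsOrthonormalFilter c → 1 ≤ Wavelet.vanishingMoments c →
      (∃! v : ℝ, Wavelet.HasParameter c v) ∧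
      (∃! φ : Wavelet.L2, Wavelet.IsScalingFunction c φ) ∧
      ∀ v : ℝ, Wavelet.HasParameter c v →
        (∀ ξ : ℝ, ‖Wavelet.m0 c ξ‖ ^ 2 = (1 + Real.cos ξ) / 2 * Wavelet.r v ξ) ∧
        v ≤ 1 ∧
        (v = 1 ↔ Wavelet.IsDaubechiesFilter c) ∧
        ∀ φ : Wavelet.L2, Wavelet.IsScalingFunction c φ →
          ∃ s₀ : ℝ, Wavelet.IsSobolevExponent φ s₀ ∧ s₀ ≤ 1 ∧
            (v = 1 → s₀ = 1) ∧ (v < 1 → s₀ < 1)) := by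
  open Wavelet in
  refine ⟨linearIndependent_cosFun, fun v ↦ ⟨r_pi_nonneg_iff v, T_cosFun v,
    fun u hu ↦ T_mem_cosSpan v hu, fun hv ↦ ⟨charpoly_transferMatrix hv,
      isEigenvalueOnSpan_iff hv, one_le_spectralRadius hv⟩⟩, exists_hasParameter_iff,
    fun c hc hm ↦ ⟨existsUnique_hasParameter hc hm, existsUnique_isScalingFunction hc,
      fun v hv ↦ ⟨hv.norm_sq_m0_eq, hv.le_one hc hm, eq_one_iff_isDaubechiesFilter hc hm hv,
        fun φ hφ ↦ hφ.exists_isSobolevExponent hc hv (hv.le_one hc hm)⟩⟩⟩
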